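/- For $u,v\in\mathbb C^n$ let $u\circledast v$ be the circular convolution, $u\odot v$ the entrywise product, $\hat u=Fu$ the unnormalized discrete Fourier transform ($F_{jk}=e^{-2\pi \mathrm i(j-1)(k-1)/n}$), and $\mathrm{dist}(u,v)=\min_{\theta\in[0,2\pi)}\|u-e^{\mathrm i\theta}v\|_2$. There are absolute constants $c,C_1',C_2'>0$ such that the following holds. Let $g$ be a complex random variable with $|g|\le\nu$ almost surely, $\mathbb E g=0$, $\mathbb E|g|^2=1$, where $\nu\ge 1$, and let $d_1,\dots,d_L$ be random vectors in $\mathbb C^n$ whose $nL$ entries are independent copies of $g$. Let $h,x\in\mathbb C^n$ be fixed with $h\ne0$, $\|x\|_2=1$ and $x$ $K$-sparse (at most $K$ nonzero entries). Let $y_l=h\circledast(d_l\odot x)+z_l$, $l=1,\dots,L$, where the noise matrix $Z=[z_1,\dots,z_L]$ (fixed, or random and possibly dependent on the masks) satisfies $\|Z\|_F\le C\|x\|_2\|h\|_2$ almost surely for some $C>0$. Let $h_0\in\mathbb C^n$ be a fixed vector with $\|h_0\|_2=1$ and $\mathrm{dist}(h_0,h/\|h\|_2)<\epsilon$, and let $\theta_0\in\mathbb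 R$ satisfy $\mathrm{dist}(h_0,h/\|h\|_2)=\|e^{\mathrm i\theta_0}h_0-h/\|h\|_2\|_2$. Put $\mu_0=\|\hat h_0\|_\infty^2/\|h_0\|_2^2=\|\hat h_0\|_\infty^2$. Suppose that $\lambda\ge 2(2\epsilon+C)\|h\|_2\|x\|_2$ and $L\ge c\,\mu_0\nu^2\log n$. Then, with probability at least $1-2/n$, the LASSO problem $$\min_{\tilde x\in\mathbb C^n}\ \frac1{2L}\sum_{l=1}^L\|h_0\circledast(d_l\odot\tilde x)-y_l\|_2^2+\lambda\|\tilde x\|_1$$ has a solution, and every solution $x^\#$ satisfies $$\left\|x^\#-e^{\mathrm i\theta_0}\|h\|_2\,x\right\|_2\le\min_{1\le k\le K}\left(C_1'\sqrt k\,\lambda+C_2'\,\frac{\|h\|_2\,\|x-x_{[k]}\|_1}{\sqrt k}\right),$$ where $x_{[k]}$ keeps $k$ entries of $x$ of largest magnitude (all entries if $k\ge n$) and sets the others to zero. -/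

import Mathlib

open MeasureTheory ProbabilityTheory
open scoped BigOperators

noncomputable section

/-- Circular convolution of `u` and `v`: the circulant matrix with first column `u`, applied
to `v`, so that the `i`-th entry is the sum over `j` of `u (i - j) * v j`, with indices taken
modulo `n`. -/
def circConv {n : ℕ} (u v : EuclideanSpace ℂ (Fin n)) : EuclideanSpace ℂ (Fin n) :=
  WithLp.toLp 2 ((Matrix.circulant u.ofLp).mulVec v.ofLp)

/-- Entrywise (Hadamard) product. -/
def hadamard {n : ℕ} (u v : EuclideanSpace ℂ (Fin n)) : EuclideanSpace ℂ (Fin n) :=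
  WithLp.toLp 2 (fun i => u i * v i)

/-- The unnormalized discrete Fourier transform (indices start at `0`). -/
def dft {n : ℕ} (u : EuclideanSpace ℂ (Fin n)) : EuclideanSpace ℂ (Fin n) :=
  WithLp.toLp 2 (fun j => ∑ k : Fin n,
    Complex.exp (-(2 * Real.pi * Complex.I * (j : ℕ) * (k : ℕ) / n)) * u k)

/-- The sup norm of a vector (the norm of `Fin n → ℂ` is the sup norm). -/
def supNorm {n : ℕ} (u : EuclideanSpace ℂ (Fin n)) : ℝ := ‖(u.ofLp : Fin n → ℂ)‖

/-- The `ℓ¹` norm of a vector. -/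
def oneNorm {n : ℕ} (u : EuclideanSpace ℂ (Fin n)) : ℝ := ∑ i, ‖u i‖

/-- The Frobenius norm of the matrix with columns `Z 0, …, Z (L - 1)`. -/
def frobNorm {n L : ℕ} (Z : Fin L → EuclideanSpace ℂ (Fin n)) : ℝ :=
  Real.sqrt (∑ l, ∑ i, ‖Z l i‖ ^ 2)

/-- The coherence parameter of a vector. -/
def coherence {n : ℕ} (u : EuclideanSpace ℂ (Fin n)) : ℝ := supNorm (dft u) ^ 2 / ‖u‖ ^ 2

/-- The distance of `u` and `v` up to a global phase. -/
def phaseDist {n : ℕ} (u v : EuclideanSpace ℂ (Fin n)) : ℝ :=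
  ⨅ θ : Set.Ico (0 : ℝ) (2 * Real.pi), ‖u - Complex.exp (Complex.I * (θ : ℝ)) • v‖

/-- `x` has at most `K` nonzero entries. -/
def IsSparse {n : ℕ} (K : ℕ) (x : EuclideanSpace ℂ (Fin n)) : Prop :=
  {i | x i ≠ 0}.ncard ≤ K

/-- `v` is a best `k`-sparse approximation of `x`: it keeps `k` entries of `x` of largest
magnitude (all of them if `n ≤ k`) and puts the others to zero. Ties may be broken in any way. -/
def IsBestSparseApprox {n : ℕ} (k : ℕ) (x v : EuclideanSpace ℂ (Fin n)) : Prop :=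
  ∃ S : Finset (Fin n), S.card = min k n ∧ (∀ i ∈ S, ∀ j ∉ S, ‖x j‖ ≤ ‖x i‖) ∧
    ∀ i, v i = if i ∈ S then x i else 0

/-- The moment conditions on a random mask entry `g` with parameter `ν`. -/
structure IsMaskVariable {Ω : Type*} [MeasurableSpace Ω] (Q : Measure Ω) (g : Ω → ℂ) (ν : ℝ) :
    Prop where
  one_le : 1 ≤ ν
  aemeasurable : AEMeasurable g Q
  norm_le : ∀ᵐ ω ∂Q, ‖g ω‖ ≤ ν
  mean_zero : ∫ ω, g ω ∂Q = 0
  second_moment : ∫ ω, ‖g ω‖ ^ 2 ∂Q = 1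

/-- The entries `d l ω j` of the `L` random masks are (jointly) independent copies of `g`. -/
structure AreIndepCopies {Ω Ω' : Type*} [MeasurableSpace Ω] [MeasurableSpace Ω'] {n L : ℕ}
    (P : Measure Ω) (d : Fin L → Ω → EuclideanSpace ℂ (Fin n)) (Q : Measure Ω') (g : Ω' → ℂ) :
    Prop where
  indep : iIndepFun (fun (p : Fin L × Fin n) (ω : Ω) => d p.1 ω p.2) P
  identDistrib : ∀ l j, IdentDistrib (fun ω => d l ω j) g P Q

/-- The objective function of the LASSO problem with kernel `h₀`, masks `d`, observations `y`
and regularization parameter `lam`. -/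
def lassoObjective {n L : ℕ} (h₀ : EuclideanSpace ℂ (Fin n))
    (d y : Fin L → EuclideanSpace ℂ (Fin n)) (lam : ℝ) (w : EuclideanSpace ℂ (Fin n)) : ℝ :=
  1 / (2 * (L : ℝ)) * ∑ l, ‖circConv h₀ (hadamard (d l) w) - y l‖ ^ 2 + lam * oneNorm w

/-- `w` is a solution of the LASSO problem, that is, a global minimizer of its objective. -/
def IsLassoSolution {n L : ℕ} (h₀ : EuclideanSpace ℂ (Fin n))
    (d y : Fin L → EuclideanSpace ℂ (Fin n)) (lam : ℝ) (w : EuclideanSpace ℂ (Fin n)) : Prop :=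
  ∀ v, lassoObjective h₀ d y lam w ≤ lassoObjective h₀ d y lam v

end

/-!
# LASSO recovery from randomly masked circular convolutions with an inaccurate kernel

Write `A w = (h₀ ⊛ (d l ⊙ w))_l` for the stacked measurement map and `X = e^{iθ₀} ‖h‖ x` for the
rescaled signal. Up to the residual `r_l = z_l - ‖h‖ (e ⊛ (d l ⊙ x))` with
`e = e^{iθ₀} h₀ - h / ‖h‖`, `‖e‖ < ε`, the observations are `A X`. Two facts about the masks
suffice, each holding with probability at least `1 - 1 / n`.

* `‖A w‖² ≥ (L / 6) ‖w‖²` for *all* `w`, sparse or not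
  (`measure_exists_sum_norm_maskedConv_lt_le`). The Gram matrices of the `L` blocks are independent,
  have mean `1`, and lie between `0` and `μ₀ ν²`, because convolution with `h₀` has operator norm
  `‖ĥ₀‖_∞` (`norm_circConv_sq_le`). So this is a matrix Chernoff bound
  (`measure_not_posSemidef_le`). Its engine is the elementary inequality
  `tr exp (A - Y) ≤ tr exp A - (1 / 3) tr (Y exp A)` for `0 ≤ Y ≤ 1 / 2` (`trace_exp_sub_le`),
  which plays the role of the Golden–Thompson inequality: it is linear in `Y`, so that the
  expectation over `Y` can be taken at once. It follows from scalar inequalities, since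
  `tr (f(A) g(B))` is a nonnegative combination of the products `f(a) g(b)` of values at eigenvalues
  (`exists_weights_trace_hermFun_mul`).
* `∑ l, ‖e ⊛ (d l ⊙ x)‖² ≤ 10 ε² L` (`measure_sum_norm_sq_ge_le`). Here `e` may have large
  coherence, but only one fixed vector is involved: the summands are squared norms of random linear
  combinations of fixed vectors, whose exponential moments are bounded by revealing one coefficient
  at a time (`integral_exp_norm_sum_smul_sq_le`).

On this event the residual satisfies `‖r‖² ≤ 2 L λ²`, and comparing the LASSO objective at a
solution and at `X` gives a quadratic inequality for the norm of the error
(`norm_lassoSolution_sub_le`). The lower bound on the whole space makes a cone condition, and hence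
the restricted isometry property, unnecessary.
-/

/-! ### Circular convolution and the discrete Fourier transform -/

/-- The discrete Fourier transform is symmetric for the bilinear pairing. -/
theorem sum_dft_mul {N : ℕ} [NeZero N] (Φ Ψ : ZMod N → ℂ) :
    ∑ k, ZMod.dft Φ k * Ψ k = ∑ j, Φ j * ZMod.dft Ψ j := by
  simp only [ZMod.dft_apply, smul_eq_mul, Finset.sum_mul, Finset.mul_sum]
  rw [Finset.sum_comm]
  refine Finset.sum_congr rfl fun j _ => Finset.sum_congr rfl fun k _ => ?_
  rw [mul_comm k j]
  ring

open scoped ComplexConjugate in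
theorem conj_dft {N : ℕ} [NeZero N] (Φ : ZMod N → ℂ) (k : ZMod N) :
    conj (ZMod.dft Φ k) = ZMod.dft (fun j => conj (Φ (-j))) k := by
  rw [ZMod.dft_comp_neg (fun j => conj (Φ j))]
  simp only [ZMod.dft_apply, smul_eq_mul, map_sum, map_mul]
  refine Finset.sum_congr rfl fun j _ => ?_
  congr 1
  rw [ZMod.stdAddChar_apply, ZMod.stdAddChar_apply, ← Circle.coe_inv_eq_conj,
    ← AddChar.map_neg_eq_inv]
  congr 2
  ring

/-- Parseval's identity for the unnormalized discrete Fourier transform on `ZMod N`. -/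
theorem sum_norm_sq_dft {N : ℕ} [NeZero N] (Φ : ZMod N → ℂ) :
    ∑ k, ‖ZMod.dft Φ k‖ ^ 2 = N * ∑ j, ‖Φ j‖ ^ 2 := by
  have h := sum_dft_mul Φ (fun k => ZMod.dft (fun j => (starRingEnd ℂ) (Φ (-j))) k)
  have h2 : ∀ j, ZMod.dft (fun k => ZMod.dft (fun j => (starRingEnd ℂ) (Φ (-j))) k) j =
      N * (starRingEnd ℂ) (Φ j) := by
    intro j
    have := congrFun (ZMod.dft_dft (fun j => (starRingEnd ℂ) (Φ (-j)))) j
    simpa using this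
  rw [Finset.sum_congr rfl fun j _ => congrArg (Φ j * ·) (h2 j)] at h
  simp only [← conj_dft] at h
  have h3 : ∀ j, Φ j * (N * (starRingEnd ℂ) (Φ j)) = ((N * ‖Φ j‖ ^ 2 : ℝ) : ℂ) := by
    intro j
    rw [mul_left_comm, Complex.mul_conj']
    push_cast
    rfl
  simp only [h3, Complex.mul_conj'] at h
  rw [Finset.mul_sum]
  exact_mod_cast h

theorem dft_convolution {N : ℕ} [NeZero N] (Φ Ψ : ZMod N → ℂ) (k : ZMod N) :
    ZMod.dft (fun i => ∑ j, Φ (i - j) * Ψ j) k = ZMod.dft Φ k * ZMod.dft Ψ k := by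
  simp only [ZMod.dft_apply, smul_eq_mul, Finset.mul_sum, Finset.sum_mul]
  rw [Finset.sum_comm]
  refine Finset.sum_congr rfl fun j _ => ?_
  rw [← Equiv.sum_comp (Equiv.addRight j)]
  refine Finset.sum_congr rfl fun i _ => ?_
  simp only [Equiv.coe_addRight, add_sub_cancel_right]
  rw [show -((i + j) * k) = -(i * k) + -(j * k) by ring, AddChar.map_add_eq_mul]
  ring

/-- Comparison with Mathlib's transform, through `ZMod (m + 1) = Fin (m + 1)`. -/
theorem dft_apply_eq_zmod_dft {m : ℕ} (u : EuclideanSpace ℂ (Fin (m + 1))) (j : Fin (m + 1)) :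
    dft u j = ZMod.dft (N := m + 1) u.ofLp j := by
  refine Eq.trans ?_ (ZMod.dft_apply (N := m + 1) u.ofLp j).symm
  change (∑ k : Fin (m + 1), Complex.exp (-(2 * Real.pi * Complex.I * (j : ℕ) * (k : ℕ) /
    (m + 1 : ℕ))) * u k) = _
  refine Finset.sum_congr rfl fun (k : Fin (m + 1)) _ => ?_
  refine Eq.trans ?_ (smul_eq_mul (ZMod.stdAddChar (N := m + 1) (-((k : ZMod (m + 1)) * j)))
    (u k)).symm
  congr 1
  have : (-((k : ZMod (m + 1)) * (j : ZMod (m + 1)))) =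
      ((-((k : ℕ) * (j : ℕ)) : ℤ) : ZMod (m + 1)) := by
    push_cast
    congr 2
    · exact (Fin.cast_val_eq_self k).symm
    · exact (Fin.cast_val_eq_self j).symm
  refine Eq.trans ?_ (congrArg ZMod.stdAddChar this.symm)
  rw [ZMod.stdAddChar_coe]
  congr 1
  push_cast
  ring

/-- Circular convolution with `u` is bounded on `ℓ²` by the sup norm of the Fourier transform
of `u`. -/
theorem norm_circConv_sq_le {n : ℕ} (u v : EuclideanSpace ℂ (Fin n)) :
    ‖circConv u v‖ ^ 2 ≤ supNorm (dft u) ^ 2 * ‖v‖ ^ 2 := by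
  cases n with
  | zero => simp [EuclideanSpace.norm_sq_eq]
  | succ m =>
    have h1 := sum_norm_sq_dft (N := m + 1) (circConv u v).ofLp
    have h2 := sum_norm_sq_dft (N := m + 1) v.ofLp
    have h3 : ∀ k, ‖ZMod.dft (N := m + 1) (circConv u v).ofLp k‖ ^ 2 ≤
        supNorm (dft u) ^ 2 * ‖ZMod.dft (N := m + 1) v.ofLp k‖ ^ 2 := by
      intro k
      have := dft_convolution (N := m + 1) u.ofLp v.ofLp k
      have h4 : ZMod.dft (N := m + 1) (circConv u v).ofLp k =
        ZMod.dft (N := m + 1) u.ofLp k * ZMod.dft (N := m + 1) v.ofLp k := this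
      rw [h4, norm_mul, mul_pow]
      gcongr
      refine (congrArg norm (dft_apply_eq_zmod_dft u k)).symm.trans_le ?_
      exact norm_le_pi_norm (dft u).ofLp k
    have h5 := Finset.sum_le_sum fun k (_ : k ∈ (Finset.univ : Finset (ZMod (m + 1)))) => h3 k
    rw [← Finset.mul_sum, h1, h2] at h5
    have h6 : ‖circConv u v‖ ^ 2 = ∑ j : ZMod (m + 1), ‖(circConv u v).ofLp j‖ ^ 2 :=
      EuclideanSpace.norm_sq_eq _
    have h7 : ‖v‖ ^ 2 = ∑ j : ZMod (m + 1), ‖v.ofLp j‖ ^ 2 :=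
      EuclideanSpace.norm_sq_eq _
    rw [h6, h7]
    have h8 : (0 : ℝ) < ((m + 1 : ℕ) : ℝ) := by positivity
    refine le_of_mul_le_mul_left ?_ h8
    linarith

theorem circConv_apply {n : ℕ} (u v : EuclideanSpace ℂ (Fin n)) (i : Fin n) :
    circConv u v i = ∑ j, u (i - j) * v j := by
  simp [circConv, Matrix.mulVec, dotProduct, Matrix.circulant_apply]

/-- Convolving with the unit vector at `0` shows that `‖u‖ ≤ ‖û‖_∞`. -/
theorem one_le_coherence {n : ℕ} {u : EuclideanSpace ℂ (Fin n)} (hu : u ≠ 0) :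
    1 ≤ coherence u := by
  cases n with
  | zero => exact absurd (Subsingleton.elim u 0) hu
  | succ m =>
    have hu' : 0 < ‖u‖ := norm_pos_iff.2 hu
    have h := norm_circConv_sq_le u (EuclideanSpace.single 0 1)
    have h2 : circConv u (EuclideanSpace.single 0 1) = u := by
      ext i
      rw [circConv_apply, Finset.sum_eq_single 0] <;> simp +contextual
    rw [h2] at h
    rw [coherence, one_le_div (by positivity)]
    simpa using h

/-! ### Trace inequalities for the matrix exponential -/

section TraceExp

open scoped Matrix ComplexOrder

variable {ι : Type*} [Fintype ι] [DecidableEq ι]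

/-- The function `f` applied to the Hermitian matrix `A` through its spectral decomposition. -/
noncomputable def hermFun {A : Matrix ι ι ℂ} (hA : A.IsHermitian) (f : ℝ → ℝ) : Matrix ι ι ℂ :=
  (hA.eigenvectorUnitary : Matrix ι ι ℂ) *
    Matrix.diagonal (fun i => (f (hA.eigenvalues i) : ℂ)) *
    (hA.eigenvectorUnitary : Matrix ι ι ℂ)ᴴ

variable {A B : Matrix ι ι ℂ}

theorem hermFun_one (hA : A.IsHermitian) : hermFun hA (fun _ => 1) = 1 := by
  have h : Matrix.diagonal (fun _ : ι => (1 : ℂ)) = 1 := Matrix.diagonal_one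
  simp only [hermFun, Complex.ofReal_one, h, mul_one]
  exact Unitary.mul_star_self_of_mem hA.eigenvectorUnitary.2

theorem hermFun_id (hA : A.IsHermitian) : hermFun hA (fun a => a) = A := by
  conv_rhs => rw [hA.spectral_theorem]
  rfl

theorem hermFun_mul (hA : A.IsHermitian) (f g : ℝ → ℝ) :
    hermFun hA f * hermFun hA g = hermFun hA (fun a => f a * g a) := by
  have h : (hA.eigenvectorUnitary : Matrix ι ι ℂ)ᴴ * (hA.eigenvectorUnitary : Matrix ι ι ℂ) = 1 :=
    Unitary.star_mul_self_of_mem hA.eigenvectorUnitary.2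
  simp only [hermFun, mul_assoc]
  rw [← mul_assoc (_ᴴ) _, h, one_mul, ← mul_assoc (Matrix.diagonal _), Matrix.diagonal_mul_diagonal]
  simp

theorem hermFun_exp (hA : A.IsHermitian) : hermFun hA Real.exp = NormedSpace.exp A := by
  have h : (hA.eigenvectorUnitary : Matrix ι ι ℂ) * (hA.eigenvectorUnitary : Matrix ι ι ℂ)ᴴ = 1 :=
    Unitary.mul_star_self_of_mem hA.eigenvectorUnitary.2
  have hu : (hA.eigenvectorUnitary : Matrix ι ι ℂ)⁻¹ = (hA.eigenvectorUnitary : Matrix ι ι ℂ)ᴴ :=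
    Matrix.inv_eq_right_inv h
  have hU : IsUnit (hA.eigenvectorUnitary : Matrix ι ι ℂ) :=
    (Unitary.toUnits hA.eigenvectorUnitary).isUnit
  conv_rhs => rw [← hermFun_id hA, hermFun, ← hu, Matrix.exp_conj _ _ hU, Matrix.exp_diagonal]
  rw [hermFun, hu]
  congr 3
  ext i
  rw [Pi.coe_exp, ← Complex.exp_eq_exp_ℂ, Complex.ofReal_exp]

/-- The trace of a product of functions of two Hermitian matrices is a nonnegative combination of
products of values at the two spectra. -/
theorem exists_weights_trace_hermFun_mul (hA : A.IsHermitian) (hB : B.IsHermitian) :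
    ∃ w : ι → ι → ℝ, (∀ i j, 0 ≤ w i j) ∧
    ∀ f g : ℝ → ℝ, (hermFun hA f * hermFun hB g).trace.re =
      ∑ i, ∑ j, w i j * (f (hA.eigenvalues i) * g (hB.eigenvalues j)) := by
  set U := (hA.eigenvectorUnitary : Matrix ι ι ℂ)
  set V := (hB.eigenvectorUnitary : Matrix ι ι ℂ)
  refine ⟨fun i j => ‖(Uᴴ * V) i j‖ ^ 2, fun i j => by positivity, fun f g => ?_⟩
  have h : (hermFun hA f * hermFun hB g).trace =
      (Matrix.diagonal (fun i => (f (hA.eigenvalues i) : ℂ)) * (Uᴴ * V) *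
        (Matrix.diagonal (fun i => (g (hB.eigenvalues i) : ℂ)) * (Uᴴ * V)ᴴ)).trace := by
    rw [Matrix.conjTranspose_mul, Matrix.conjTranspose_conjTranspose]
    simp only [hermFun, mul_assoc]
    rw [Matrix.trace_mul_comm]
    simp only [mul_assoc]
    rfl
  rw [h]
  simp only [Matrix.trace, Matrix.diag_apply, Matrix.mul_apply (M := Matrix.diagonal _ * (Uᴴ * V)),
    Matrix.diagonal_mul, Matrix.conjTranspose_apply, Complex.re_sum]
  refine Finset.sum_congr rfl fun i _ => Finset.sum_congr rfl fun j _ => ?_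
  rw [show (f (hA.eigenvalues i) : ℂ) * (Uᴴ * V) i j * (g (hB.eigenvalues j) * star ((Uᴴ * V) i j))
    = (f (hA.eigenvalues i) * g (hB.eigenvalues j)) * ((Uᴴ * V) i j * star ((Uᴴ * V) i j)) by ring]
  rw [Complex.star_def, Complex.mul_conj']
  norm_cast
  ring

theorem exp_le_one_add_add_sq_mul (u : ℝ) :
    Real.exp u ≤ 1 + u + u ^ 2 * (1 + Real.exp u) := by
  rcases le_or_gt 0 u with hu | hu
  · rcases le_or_gt 1 u with h1 | h1
    · nlinarith [Real.exp_pos u, mul_nonneg (sub_nonneg.2 h1) (Real.exp_pos u).le,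
        mul_nonneg (mul_nonneg (sub_nonneg.2 h1) hu) (Real.exp_pos u).le]
    · have h := Real.add_one_le_exp (-u)
      have h2 : Real.exp (-u) * Real.exp u = 1 := by rw [← Real.exp_add]; simp
      have h3 : (1 - u) * Real.exp u ≤ 1 := by nlinarith [Real.exp_pos u]
      nlinarith [Real.exp_pos u]
  · have h := Real.add_one_le_exp (-u)
    have h2 : Real.exp (-u) * Real.exp u = 1 := by rw [← Real.exp_add]; simp
    have h3 : Real.exp u ≤ 1 + u + u ^ 2 := by
      by_contra! hc
      nlinarith [Real.exp_pos u, sq_nonneg (u + 1 / 2), mul_pos (neg_pos.2 hu) (sq_pos_of_neg hu)]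
    nlinarith [Real.exp_pos u, sq_nonneg u]

/-- The scalar inequality behind `trace_exp_le_second_order`. The term with `exp b` in the remainder
is what makes it valid for `a - b` of either sign and any size. -/
theorem exp_le_of_sub (a b : ℝ) : Real.exp b ≤
    Real.exp a - (a - b) * Real.exp a + (a - b) ^ 2 * (Real.exp a + Real.exp b) := by
  have h := mul_le_mul_of_nonneg_left (exp_le_one_add_add_sq_mul (b - a)) (Real.exp_pos a).le
  have h2 : Real.exp a * Real.exp (b - a) = Real.exp b := by rw [← Real.exp_add]; simp
  nlinarith

theorem exp_add_sub_mul_le (a b : ℝ) : Real.exp b + (a - b) * Real.exp b ≤ Real.exp a := by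
  have h := mul_le_mul_of_nonneg_left (Real.add_one_le_exp (a - b)) (Real.exp_pos b).le
  have h2 : Real.exp b * Real.exp (a - b) = Real.exp a := by rw [← Real.exp_add]; simp
  nlinarith

/-- Convexity inequality for `A ↦ tr exp A`, a case of Klein's inequality. -/
theorem trace_exp_add_le (hA : A.IsHermitian) (hB : B.IsHermitian) :
    (NormedSpace.exp B).trace.re + ((A - B) * NormedSpace.exp B).trace.re ≤
    (NormedSpace.exp A).trace.re := by
  obtain ⟨w, hw, h⟩ := exists_weights_trace_hermFun_mul hA hB
  have e1 := h (fun _ => 1) Real.exp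
  have e2 := h (fun a => a) Real.exp
  have e3 := h (fun _ => 1) (fun b => b * Real.exp b)
  have e4 := h Real.exp (fun _ => 1)
  simp only [← hermFun_mul, hermFun_one, hermFun_id, hermFun_exp, one_mul, mul_one] at e1 e2 e3 e4
  rw [sub_mul, Matrix.trace_sub, Complex.sub_re, e1, e2, e3, e4]
  simp only [← Finset.sum_add_distrib, ← Finset.sum_sub_distrib]
  refine Finset.sum_le_sum fun i _ => Finset.sum_le_sum fun j _ => ?_
  nlinarith [mul_le_mul_of_nonneg_left (exp_add_sub_mul_le (hA.eigenvalues i) (hB.eigenvalues j))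
    (hw i j)]

/-- A second-order upper bound for `B ↦ tr exp B`. The remainder is again a combination of traces
`tr (f(A) g(B))`, so the bound reduces to `exp_le_of_sub` for each pair of eigenvalues. -/
theorem trace_exp_le_second_order (hA : A.IsHermitian) (hB : B.IsHermitian) :
    (NormedSpace.exp B).trace.re ≤
    (NormedSpace.exp A).trace.re - ((A - B) * NormedSpace.exp A).trace.re +
      (((A - B) * (A - B)) * NormedSpace.exp A).trace.re +
      (((A - B) * (A - B)) * NormedSpace.exp B).trace.re := by
  obtain ⟨w, hw, h⟩ := exists_weights_trace_hermFun_mul hA hB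
  have e1 := h (fun _ => 1) Real.exp
  have e2 := h Real.exp (fun _ => 1)
  have e3 := h (fun a => a * Real.exp a) (fun _ => 1)
  have e4 := h Real.exp (fun b => b)
  have e5 := h (fun a => a * (a * Real.exp a)) (fun _ => 1)
  have e6 := h (fun a => a * Real.exp a) (fun b => b)
  have e7 := h Real.exp (fun b => b * b)
  have e8 := h (fun a => a * a) Real.exp
  have e9 := h (fun a => a) (fun b => b * Real.exp b)
  have e10 := h (fun _ => 1) (fun b => b * (b * Real.exp b))
  have e11 := h (fun a => Real.exp a * a) (fun b => b)
  have e12 := h (fun a => a) (fun b => Real.exp b * b)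
  simp only [← hermFun_mul, hermFun_one, hermFun_id, hermFun_exp, one_mul, mul_one, mul_assoc]
    at e1 e2 e3 e4 e5 e6 e7 e8 e9 e10 e11 e12
  have t1 : (B * NormedSpace.exp A).trace = (NormedSpace.exp A * B).trace :=
    Matrix.trace_mul_comm _ _
  have t2 : (A * (B * NormedSpace.exp A)).trace = (NormedSpace.exp A * (A * B)).trace := by
    rw [← mul_assoc, Matrix.trace_mul_comm]
  have t3 : (B * (A * NormedSpace.exp A)).trace = (A * (NormedSpace.exp A * B)).trace := by
    rw [Matrix.trace_mul_comm, mul_assoc]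
  have t4 : (B * (B * NormedSpace.exp A)).trace = (NormedSpace.exp A * (B * B)).trace := by
    rw [← mul_assoc, Matrix.trace_mul_comm]
  have t5 : (B * (A * NormedSpace.exp B)).trace = (A * (NormedSpace.exp B * B)).trace := by
    rw [Matrix.trace_mul_comm, mul_assoc]
  simp only [mul_sub, sub_mul, Matrix.trace_sub, Complex.sub_re, mul_assoc, t1, t2, t3, t4, t5]
  rw [e1, e2, e3, e4, e5, e6, e7, e8, e9, e10, e11, e12]
  simp only [← Finset.sum_add_distrib, ← Finset.sum_sub_distrib]
  refine Finset.sum_le_sum fun i _ => Finset.sum_le_sum fun j _ => ?_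
  refine (mul_le_mul_of_nonneg_left (exp_le_of_sub (hA.eigenvalues i) (hB.eigenvalues j))
    (hw i j)).trans_eq ?_
  ring

theorem posSemidef_exp (hA : A.IsHermitian) : (NormedSpace.exp A).PosSemidef := by
  rw [← hermFun_exp hA, hermFun]
  refine Matrix.PosSemidef.mul_mul_conjTranspose_same ?_ _
  rw [Matrix.posSemidef_diagonal_iff]
  intro i
  exact_mod_cast (Real.exp_pos _).le

theorem trace_mul_exp_nonneg (hA : A.IsHermitian) (hB : B.PosSemidef) :
    0 ≤ (B * NormedSpace.exp A).trace.re := by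
  have hE := hermFun_mul hA (fun a => Real.exp (a / 2)) (fun a => Real.exp (a / 2))
  have h2 : (fun a => Real.exp (a / 2) * Real.exp (a / 2)) = Real.exp := by
    ext a
    rw [← Real.exp_add, add_halves]
  have h3 : (hermFun hA (fun a => Real.exp (a / 2)))ᴴ = hermFun hA (fun a => Real.exp (a / 2)) := by
    simp only [hermFun, Matrix.conjTranspose_mul, Matrix.conjTranspose_conjTranspose,
      Matrix.diagonal_conjTranspose, mul_assoc]
    congr 3
    ext i
    simp only [Pi.star_apply, Complex.star_def, Complex.conj_ofReal]
  rw [h2, hermFun_exp] at hE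
  rw [← hE, ← mul_assoc, Matrix.trace_mul_comm, ← mul_assoc]
  nth_rewrite 2 [← h3]
  exact (Complex.nonneg_iff.1 (hB.mul_mul_conjTranspose_same _).trace_nonneg).1

/-- The trace of `exp` decreases by a definite amount when a small positive matrix is
subtracted. This replaces the Golden–Thompson inequality in the matrix Laplace transform
argument. -/
theorem trace_exp_sub_le {Y : Matrix ι ι ℂ} (hA : A.IsHermitian) (hY : Y.PosSemidef)
    (hY2 : ((1 / 2 : ℂ) • (1 : Matrix ι ι ℂ) - Y).PosSemidef) :
    (NormedSpace.exp (A - Y)).trace.re ≤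
      (NormedSpace.exp A).trace.re - 1 / 3 * (Y * NormedSpace.exp A).trace.re := by
  have hB : (A - Y).IsHermitian := hA.sub hY.isHermitian
  have h1 := trace_exp_add_le hA hB
  have h2 := trace_exp_le_second_order hA hB
  rw [sub_sub_cancel] at h1 h2
  -- `Y / 2 - Y ^ 2` is a sum of conjugates of the positive matrices `1 / 2 - Y` and `Y`
  have hs : ((1 / 2 : ℂ) • Y - Y * Y).PosSemidef := by
    have e : (1 / 2 : ℂ) • Y - Y * Y = (2 : ℂ) • (Y * ((1 / 2 : ℂ) • (1 : Matrix ι ι ℂ) - Y) * Yᴴ +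
        ((1 / 2 : ℂ) • (1 : Matrix ι ι ℂ) - Y) * Y * ((1 / 2 : ℂ) • (1 : Matrix ι ι ℂ) - Y)ᴴ) := by
      rw [hY.isHermitian.eq, hY2.isHermitian.eq]
      simp only [mul_sub, sub_mul, smul_add, smul_sub, Matrix.smul_mul, Matrix.mul_smul,
        one_mul, mul_one, smul_smul,
        mul_assoc]
      module
    rw [e]
    exact ((hY2.mul_mul_conjTranspose_same Y).add (hY.mul_mul_conjTranspose_same _)).smul
      (by norm_num)
  have key : ∀ {C : Matrix ι ι ℂ}, C.IsHermitian → ((Y * Y) * NormedSpace.exp C).trace.re ≤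
      1 / 2 * (Y * NormedSpace.exp C).trace.re := by
    intro C hC
    have := trace_mul_exp_nonneg hC hs
    rw [sub_mul, Matrix.smul_mul, Matrix.trace_sub, Matrix.trace_smul, smul_eq_mul] at this
    have e : ((1 / 2 : ℂ) * (Y * NormedSpace.exp C).trace).re =
        1 / 2 * (Y * NormedSpace.exp C).trace.re := by
      rw [show (1 / 2 : ℂ) = ((1 / 2 : ℝ) : ℂ) by push_cast; rfl, Complex.re_ofReal_mul]
    rw [Complex.sub_re, e] at this
    linarith
  linarith [key hA, key hB]

/-- If `tr exp A ≤ exp t`, then `A ≤ t`, as each eigenvalue contributes a positive term. -/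
theorem posSemidef_smul_one_sub_of_trace_exp_le (hA : A.IsHermitian) {t : ℝ}
    (ht : (NormedSpace.exp A).trace.re ≤ Real.exp t) :
    ((t : ℂ) • (1 : Matrix ι ι ℂ) - A).PosSemidef := by
  have h : (t : ℂ) • (1 : Matrix ι ι ℂ) - A = hermFun hA (fun a => t - a) := by
    conv_lhs => rw [← hermFun_one hA]; right; rw [← hermFun_id hA]
    simp only [hermFun, ← Matrix.smul_mul, ← Matrix.sub_mul]
    congr 1
    ext i j
    simp only [Matrix.sub_apply, Matrix.smul_apply, Matrix.mul_diagonal, smul_eq_mul]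
    push_cast
    ring
  rw [h, hermFun]
  refine Matrix.PosSemidef.mul_mul_conjTranspose_same ?_ _
  rw [Matrix.posSemidef_diagonal_iff]
  intro i
  have e : (NormedSpace.exp A).trace.re = ∑ i, Real.exp (hA.eigenvalues i) := by
    have hu : (hA.eigenvectorUnitary : Matrix ι ι ℂ)ᴴ *
      (hA.eigenvectorUnitary : Matrix ι ι ℂ) = 1 :=
      Unitary.star_mul_self_of_mem hA.eigenvectorUnitary.2
    rw [← hermFun_exp hA, hermFun, Matrix.trace_mul_comm, ← mul_assoc, hu, one_mul,
      Matrix.trace_diagonal, ← Complex.ofReal_sum, Complex.ofReal_re]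
  rw [e] at ht
  have h3 := (Finset.single_le_sum (f := fun i => Real.exp (hA.eigenvalues i))
    (fun i _ => (Real.exp_pos _).le) (Finset.mem_univ i)).trans ht
  have := Real.exp_le_exp.1 h3
  have h4 : (0 : ℝ) ≤ t - hA.eigenvalues i := by linarith
  exact_mod_cast h4

end TraceExp

/-! ### A matrix Chernoff bound -/

theorem integrable_of_continuous_of_bounded {Ω : Type*} [MeasurableSpace Ω] {P : Measure Ω}
    [IsFiniteMeasure P] {E : Type*} [NormedAddCommGroup E]
    [ProperSpace E] [MeasurableSpace E] [BorelSpace E] {X : Ω → E} (hX : Measurable X) {C : ℝ}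
    (hC : ∀ ω, ‖X ω‖ ≤ C) {f : E → ℂ} (hf : Continuous f) : Integrable (fun ω => f (X ω)) P := by
  obtain ⟨D, hD⟩ := (isCompact_closedBall (0 : E) C).exists_bound_of_continuousOn hf.continuousOn
  refine Integrable.of_bound (hf.measurable.comp hX).aestronglyMeasurable D
    (ae_of_all _ fun ω => ?_)
  exact hD _ (by simpa using hC ω)

section MatrixChernoff

open scoped Matrix ComplexOrder

variable {ι : Type*} [Fintype ι] [DecidableEq ι]

theorem continuous_matrix_exp_apply (i j : ι) :
    Continuous (fun M : ι → ι → ℂ => NormedSpace.exp (-(Matrix.of M)) i j) := by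
  let _ : SeminormedRing (Matrix ι ι ℂ) := Matrix.linftyOpSemiNormedRing
  let _ : NormedRing (Matrix ι ι ℂ) := Matrix.linftyOpNormedRing
  let _ : NormedAlgebra ℂ (Matrix ι ι ℂ) := Matrix.linftyOpNormedAlgebra
  let _ : NormedAlgebra ℚ (Matrix ι ι ℂ) := NormedAlgebra.restrictScalars ℚ ℂ _
  have h : Continuous (fun M : Matrix ι ι ℂ => NormedSpace.exp M) := NormedSpace.exp_continuous
  have h2 : Continuous (fun M : ι → ι → ℂ => (Matrix.of M : Matrix ι ι ℂ)) := continuous_id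
  exact (h.comp h2.neg).matrix_elem i j

variable {Ω κ : Type*} [MeasurableSpace Ω] {P : Measure Ω} [IsProbabilityMeasure P]

/-- The trace exponential of minus a sum of independent positive matrices with mean `p • 1`: each
summand contributes the factor `1 - p / 3`. Matrices are encoded as functions `ι → ι → ℂ`, which
carry a measurable structure. -/
theorem integral_trace_exp_neg_sum_le {Y : κ → Ω → ι → ι → ℂ} (hm : ∀ l, Measurable (Y l))
    (hi : iIndepFun Y P) (hpos : ∀ l ω, (Matrix.of (Y l ω)).PosSemidef)
    (hle : ∀ l ω, ((1 / 2 : ℂ) • (1 : Matrix ι ι ℂ) - Matrix.of (Y l ω)).PosSemidef)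
    {C : ℝ} (hC : ∀ l ω, ‖Y l ω‖ ≤ C) {p : ℝ} (hp : p ≤ 3)
    (hE : ∀ l i j, ∫ ω, Y l ω i j ∂P = if i = j then (p : ℂ) else 0) (s : Finset κ) :
    ∫ ω, (NormedSpace.exp (-(Matrix.of (∑ l ∈ s, Y l ω)))).trace.re ∂P ≤
      Fintype.card ι * (1 - p / 3) ^ s.card := by
  classical
  have hSm : ∀ s : Finset κ, Measurable (fun ω => ∑ l ∈ s, Y l ω) := fun s =>
    Finset.measurable_sum _ fun l _ => hm l
  have hSb : ∀ (s : Finset κ) ω, ‖∑ l ∈ s, Y l ω‖ ≤ s.card * C := by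
    intro s ω
    refine (norm_sum_le_of_le _ fun l _ => hC l ω).trans ?_
    simp
  have hint : ∀ (s : Finset κ) i j,
      Integrable (fun ω => NormedSpace.exp (-(Matrix.of (∑ l ∈ s, Y l ω))) i j) P := fun s i j =>
    integrable_of_continuous_of_bounded (hSm s) (hSb s) (continuous_matrix_exp_apply i j)
  have hintY : ∀ l i j, Integrable (fun ω => Y l ω i j) P := fun l i j =>
    integrable_of_continuous_of_bounded (hm l) (hC l) (f := fun M => M i j) (by fun_prop)
  have htr : ∀ s : Finset κ, Integrable
      (fun ω => (NormedSpace.exp (-(Matrix.of (∑ l ∈ s, Y l ω)))).trace) P := fun s =>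
    integrable_finsetSum _ fun i _ => hint s i i
  induction s using Finset.induction_on with
  | empty => simp [Matrix.trace_one]
  | insert l s hl ih =>
    have hind : ∀ i j, IndepFun (fun ω => Y l ω i j)
        (fun ω => NormedSpace.exp (-(Matrix.of (∑ l ∈ s, Y l ω))) j i) P := by
      intro i j
      have h := (hi.indepFun_finsetSum_of_notMem hm hl).symm
      have e : (∑ j ∈ s, Y j) = fun ω => ∑ l ∈ s, Y l ω := funext fun ω => Finset.sum_apply _ _ _
      rw [e] at h
      exact h.comp (φ := fun M : ι → ι → ℂ => M i j)
        (ψ := fun M => NormedSpace.exp (-(Matrix.of M)) j i) (by fun_prop)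
        (continuous_matrix_exp_apply j i).measurable
    have hintm : ∀ i j, Integrable (fun ω => Y l ω i j *
        NormedSpace.exp (-(Matrix.of (∑ l ∈ s, Y l ω))) j i) P := fun i j =>
      (hind i j).integrable_mul (hintY l i j) (hint s j i)
    have hintt : Integrable (fun ω => (Matrix.of (Y l ω) *
        NormedSpace.exp (-(Matrix.of (∑ l ∈ s, Y l ω)))).trace) P := by
      simp only [Matrix.trace, Matrix.diag_apply, Matrix.mul_apply, Matrix.of_apply]
      exact integrable_finsetSum _ fun i _ => integrable_finsetSum _ fun j _ => hintm i j
    -- by independence and `E Y l = p • 1`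
    have hprod : ∫ ω, (Matrix.of (Y l ω) *
        NormedSpace.exp (-(Matrix.of (∑ l ∈ s, Y l ω)))).trace ∂P =
        p * ∫ ω, (NormedSpace.exp (-(Matrix.of (∑ l ∈ s, Y l ω)))).trace ∂P := by
      simp only [Matrix.trace, Matrix.diag_apply, Matrix.mul_apply, Matrix.of_apply]
      rw [integral_finsetSum _ fun i _ => integrable_finsetSum _ fun j _ => hintm i j,
        integral_finsetSum _ fun i _ => hint s i i, Finset.mul_sum]
      refine Finset.sum_congr rfl fun i _ => ?_
      rw [integral_finsetSum _ fun j _ => hintm i j, Finset.sum_eq_single i]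
      · rw [(hind i i).integral_fun_mul_eq_mul_integral (hintY l i i).aestronglyMeasurable
          (hint s i i).aestronglyMeasurable, hE, if_pos rfl]
      · intro j _ hj
        rw [(hind i j).integral_fun_mul_eq_mul_integral (hintY l i j).aestronglyMeasurable
          (hint s j i).aestronglyMeasurable, hE, if_neg hj.symm, zero_mul]
      · simp
    have hre : ∫ ω, (Matrix.of (Y l ω) *
        NormedSpace.exp (-(Matrix.of (∑ l ∈ s, Y l ω)))).trace.re ∂P =
        p * ∫ ω, (NormedSpace.exp (-(Matrix.of (∑ l ∈ s, Y l ω)))).trace.re ∂P := by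
      have h1 := integral_re hintt
      have h2 := integral_re (htr s)
      simp only [RCLike.re_eq_complex_re] at h1 h2
      rw [h1, h2, hprod, Complex.re_ofReal_mul]
    have hpt : ∀ ω, (NormedSpace.exp (-(Matrix.of (∑ l ∈ insert l s, Y l ω)))).trace.re ≤
        (NormedSpace.exp (-(Matrix.of (∑ l ∈ s, Y l ω)))).trace.re - 1 / 3 * (Matrix.of (Y l ω) *
        NormedSpace.exp (-(Matrix.of (∑ l ∈ s, Y l ω)))).trace.re := by
      intro ω
      have hS : (-(Matrix.of (∑ l ∈ s, Y l ω)) : Matrix ι ι ℂ).IsHermitian := by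
        refine Matrix.IsHermitian.neg ?_
        have : (Matrix.of (∑ l ∈ s, Y l ω) : Matrix ι ι ℂ) = ∑ l ∈ s, Matrix.of (Y l ω) :=
          map_sum Matrix.ofAddEquiv _ _
        rw [this]
        exact (Matrix.posSemidef_sum s fun l _ => hpos l ω).isHermitian
      have h := trace_exp_sub_le hS (hpos l ω) (hle l ω)
      have e : -(Matrix.of (∑ l ∈ s, Y l ω)) - Matrix.of (Y l ω) =
          (-(Matrix.of (∑ l ∈ insert l s, Y l ω)) : Matrix ι ι ℂ) := by
        rw [Finset.sum_insert hl]
        ext i j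
        simp only [Matrix.sub_apply, Matrix.neg_apply, Matrix.of_apply, Pi.add_apply]
        ring
      rwa [e] at h
    have htrre : ∀ s : Finset κ, Integrable
        (fun ω => (NormedSpace.exp (-(Matrix.of (∑ l ∈ s, Y l ω)))).trace.re) P := fun s =>
      (htr s).re
    have hinttre : Integrable (fun ω => 1 / 3 * (Matrix.of (Y l ω) *
        NormedSpace.exp (-(Matrix.of (∑ l ∈ s, Y l ω)))).trace.re) P := hintt.re.const_mul (1 / 3)
    have hstep := integral_mono (htrre (insert l s)) ((htrre s).sub hinttre) hpt
    have hrw : ∫ ω, ((NormedSpace.exp (-(Matrix.of (∑ l ∈ s, Y l ω)))).trace.re -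
        1 / 3 * (Matrix.of (Y l ω) *
        NormedSpace.exp (-(Matrix.of (∑ l ∈ s, Y l ω)))).trace.re) ∂P =
        (1 - p / 3) * ∫ ω, (NormedSpace.exp (-(Matrix.of (∑ l ∈ s, Y l ω)))).trace.re ∂P := by
      rw [integral_sub (htrre s) hinttre, integral_const_mul, hre]
      ring
    refine (hstep.trans_eq hrw).trans ?_
    rw [Finset.card_insert_of_notMem hl, pow_succ]
    have := mul_le_mul_of_nonneg_left ih (show 0 ≤ 1 - p / 3 by linarith)
    linarith

/-- Lower tail of the smallest eigenvalue of a sum of independent positive matrices with mean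
`p • 1`: it is at least one sixth of its mean value, outside a small event. -/
theorem measure_not_posSemidef_le {Y : κ → Ω → ι → ι → ℂ} (hm : ∀ l, Measurable (Y l))
    (hi : iIndepFun Y P) (hpos : ∀ l ω, (Matrix.of (Y l ω)).PosSemidef)
    (hle : ∀ l ω, ((1 / 2 : ℂ) • (1 : Matrix ι ι ℂ) - Matrix.of (Y l ω)).PosSemidef)
    {C : ℝ} (hC : ∀ l ω, ‖Y l ω‖ ≤ C) {p : ℝ} (hp : p ≤ 3)
    (hE : ∀ l i j, ∫ ω, Y l ω i j ∂P = if i = j then (p : ℂ) else 0) (s : Finset κ) :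
    P.real {ω | ¬ ((Matrix.of (∑ l ∈ s, Y l ω)) -
      ((s.card * p / 6 : ℝ) : ℂ) • (1 : Matrix ι ι ℂ)).PosSemidef} ≤
      Fintype.card ι * Real.exp (-(s.card * p / 6)) := by
  set t : ℝ := s.card * p / 6 with ht
  have hH : ∀ ω, (-(Matrix.of (∑ l ∈ s, Y l ω)) : Matrix ι ι ℂ).IsHermitian := by
    intro ω
    refine Matrix.IsHermitian.neg ?_
    have : (Matrix.of (∑ l ∈ s, Y l ω) : Matrix ι ι ℂ) = ∑ l ∈ s, Matrix.of (Y l ω) :=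
      map_sum Matrix.ofAddEquiv _ _
    rw [this]
    exact (Matrix.posSemidef_sum s fun l _ => hpos l ω).isHermitian
  have hsub : {ω | ¬ ((Matrix.of (∑ l ∈ s, Y l ω)) - (t : ℂ) • (1 : Matrix ι ι ℂ)).PosSemidef} ⊆
      {ω | Real.exp (-t) ≤ (NormedSpace.exp (-(Matrix.of (∑ l ∈ s, Y l ω)))).trace.re} := by
    intro ω hω
    by_contra hc
    simp only [Set.mem_ofPred_eq, not_le] at hc
    refine hω ?_
    have := posSemidef_smul_one_sub_of_trace_exp_le (hH ω) hc.le
    convert this using 1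
    push_cast
    module
  have hint : Integrable
      (fun ω => (NormedSpace.exp (-(Matrix.of (∑ l ∈ s, Y l ω)))).trace.re) P := by
    refine Integrable.re (𝕜 := ℂ) (f := fun ω =>
      (NormedSpace.exp (-(Matrix.of (∑ l ∈ s, Y l ω)))).trace) ?_
    refine integrable_finsetSum _ fun i _ => integrable_of_continuous_of_bounded
      (C := s.card * C) (Finset.measurable_sum _ fun l _ => hm l) (fun ω => ?_)
      (continuous_matrix_exp_apply i i)
    refine (norm_sum_le_of_le _ fun l _ => hC l ω).trans ?_
    simp
  have hmk := mul_meas_ge_le_integral_of_nonneg (ae_of_all P fun ω =>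
    (Complex.nonneg_iff.1 (posSemidef_exp (hH ω)).trace_nonneg).1) hint (Real.exp (-t))
  have h1 := integral_trace_exp_neg_sum_le hm hi hpos hle hC hp hE s
  have h2 : (1 - p / 3) ^ s.card ≤ Real.exp (-2 * t) := by
    calc (1 - p / 3) ^ s.card ≤ Real.exp (-(p / 3)) ^ s.card := by
          refine pow_le_pow_left₀ (by linarith) ?_ _
          have := Real.add_one_le_exp (-(p / 3))
          linarith
      _ = Real.exp (-2 * t) := by
          rw [← Real.exp_nat_mul, ht]
          congr 1
          ring
  refine (measureReal_mono hsub).trans ?_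
  have h3 : Real.exp (-2 * t) = Real.exp (-t) * Real.exp (-t) := by
    rw [← Real.exp_add]; congr 1; ring
  refine le_of_mul_le_mul_left ?_ (Real.exp_pos (-t))
  calc _ ≤ _ := hmk
    _ ≤ _ := h1
    _ ≤ Fintype.card ι * Real.exp (-2 * t) := by gcongr
    _ = _ := by rw [h3]; ring

end MatrixChernoff

/-! ### Independence of blocks -/

/-- Grouping a doubly indexed family of independent random variables by the first index gives
independent random vectors. -/
theorem iIndepFun_blocks {Ω ι κ E : Type*} [MeasurableSpace Ω] {P : Measure Ω}
    [MeasurableSpace E] {X : ι × κ → Ω → E}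
    (hX : iIndepFun X P) (hm : ∀ p, Measurable (X p)) :
    iIndepFun (fun (i : ι) (ω : Ω) (j : κ) => X (i, j) ω) P := by
  have := hX.isProbabilityMeasure
  have : ∀ i j, IsProbabilityMeasure (P.map (X (i, j))) :=
    fun i j => Measure.isProbabilityMeasure_map (hm _).aemeasurable
  have hb : ∀ i, Measurable (fun ω (j : κ) => X (i, j) ω) := fun i =>
    measurable_pi_iff.2 fun j => hm (i, j)
  rw [iIndepFun_iff_map_fun_eq_infinitePi_map hb]
  have h1 : ∀ i, P.map (fun ω (j : κ) => X (i, j) ω) =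
      Measure.infinitePi (fun j => P.map (X (i, j))) := fun i =>
    (hX.precomp (Prod.mk_right_injective i)).map_fun_eq_infinitePi_map (fun j => hm (i, j))
  simp only [h1]
  rw [← Measure.infinitePi_map_curry (fun i j => P.map (X (i, j)))]
  have h2 := hX.map_fun_eq_infinitePi_map hm
  simp only [Prod.mk.eta]
  rw [← h2, Measure.map_map (by fun_prop) (measurable_pi_iff.2 hm)]
  rfl

/-- Fubini's theorem for independent random variables. -/
theorem integral_indepFun_eq {Ω V W : Type*} [MeasurableSpace Ω] {P : Measure Ω}
    [IsProbabilityMeasure P] [MeasurableSpace V] [MeasurableSpace W] {X : Ω → V} {Y : Ω → W}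
    (hX : Measurable X) (hY : Measurable Y) (h : IndepFun X Y P) {f : V × W → ℝ}
    (hf : Measurable f) (hi : Integrable (fun ω => f (X ω, Y ω)) P) :
    ∫ ω, f (X ω, Y ω) ∂P = ∫ ω, ∫ ω', f (X ω, Y ω') ∂P ∂P := by
  have hmap := h.map_prod_eq_prod_map_map hX.aemeasurable hY.aemeasurable
  have : IsProbabilityMeasure (P.map X) := Measure.isProbabilityMeasure_map hX.aemeasurable
  have : IsProbabilityMeasure (P.map Y) := Measure.isProbabilityMeasure_map hY.aemeasurable
  have e1 : ∫ ω, f (X ω, Y ω) ∂P = ∫ z, f z ∂(P.map (fun ω => (X ω, Y ω))) :=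
    (integral_map (hX.prodMk hY).aemeasurable hf.aestronglyMeasurable).symm
  have hi' : Integrable f (P.map (fun ω => (X ω, Y ω))) :=
    (integrable_map_measure hf.aestronglyMeasurable (hX.prodMk hY).aemeasurable).2 hi
  rw [hmap] at hi'
  rw [e1, hmap, integral_prod _ hi', integral_map hX.aemeasurable
    hi'.integral_prod_left.aestronglyMeasurable]
  refine integral_congr_ae (ae_of_all _ fun ω => ?_)
  exact integral_map hY.aemeasurable (hf.comp measurable_prodMk_left).aestronglyMeasurable

/-! ### Exponential square moments of random linear combinations -/

section SquareExp

theorem integrable_exp_norm_sq {Ω V : Type*} [MeasurableSpace Ω] {P : Measure Ω} [IsFiniteMeasure P]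
    [NormedAddCommGroup V] [MeasurableSpace V] [BorelSpace V] {X : Ω → V} (hX : Measurable X)
    {C : ℝ} (hC : ∀ ω, ‖X ω‖ ≤ C)
    {s : ℝ} (hs : 0 ≤ s) : Integrable (fun ω => Real.exp (s * ‖X ω‖ ^ 2)) P := by
  refine Integrable.of_bound ((hX.norm.pow_const 2).const_mul s).exp.aestronglyMeasurable
    (Real.exp (s * C ^ 2)) (ae_of_all _ fun ω => ?_)
  rw [Real.norm_of_nonneg (Real.exp_pos _).le]
  have := hC ω
  gcongr

variable {Ω V : Type*} [MeasurableSpace Ω] {P : Measure Ω} [IsProbabilityMeasure P]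
  [NormedAddCommGroup V] [InnerProductSpace ℂ V]

theorem exp_le_one_add_two_mul {t : ℝ} (h0 : 0 ≤ t) (h1 : t ≤ 1 / 2) :
    Real.exp t ≤ 1 + 2 * t := by
  have h := Real.add_one_le_exp (-t)
  have h2 : Real.exp (-t) * Real.exp t = 1 := by rw [← Real.exp_add]; simp
  have h3 : (1 - t) * Real.exp t ≤ 1 := by nlinarith [Real.exp_pos t]
  by_contra! hc
  nlinarith

theorem exp_le_two_mul_exp_sq (M : ℝ) : Real.exp M ≤ 2 * Real.exp (M ^ 2) := by
  have h1 : Real.exp M ≤ Real.exp (1 / 4 + M ^ 2) :=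
    Real.exp_le_exp.2 (by nlinarith [sq_nonneg (M - 1 / 2)])
  have h2 := exp_le_one_add_two_mul (t := 1 / 4) (by norm_num) (by norm_num)
  rw [Real.exp_add] at h1
  nlinarith [Real.exp_pos (M ^ 2)]

/-- Adding an independent centred term `d • m` with `d` bounded by `ν` and of variance at most `1`
changes the exponential square moment only slightly. -/
theorem integral_exp_norm_add_smul_sq_le {d : Ω → ℂ} {ν : ℝ} (hd : Measurable d)
    (hν : ∀ ω, ‖d ω‖ ≤ ν) (h0 : ∫ ω, d ω ∂P = 0) (h1 : ∫ ω, ‖d ω‖ ^ 2 ∂P ≤ 1) (z m : V) {s : ℝ}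
    (hs : 0 ≤ s) (hsm : s * ν ^ 2 * ‖m‖ ^ 2 ≤ 1 / 2) :
    ∫ ω, Real.exp (s * ‖z + d ω • m‖ ^ 2) ∂P ≤
      Real.exp (s * (1 + 4 * s * ν ^ 2 * ‖m‖ ^ 2) * ‖z‖ ^ 2 + 4 * s * ‖m‖ ^ 2) := by
  obtain ⟨ω₀⟩ : Nonempty Ω := nonempty_of_isProbabilityMeasure P
  have hν0 : 0 ≤ ν := (norm_nonneg _).trans (hν ω₀)
  set M : ℝ := 2 * s * ‖z‖ * ν * ‖m‖ with hM
  have hM0 : 0 ≤ M := by positivity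
  -- the cross term of `s * ‖z + d • m‖ ^ 2`, to which Hoeffding's lemma applies
  set X : Ω → ℝ := fun ω => 2 * s * (d ω * inner ℂ z m).re with hX
  have hdi : Integrable d P := Integrable.of_bound hd.aestronglyMeasurable ν (ae_of_all _ hν)
  have hXm : Measurable X := by
    simp only [hX]
    fun_prop
  have hXM : ∀ ω, |X ω| ≤ M := by
    intro ω
    have e1 : |(d ω * inner ℂ z m).re| ≤ ν * (‖z‖ * ‖m‖) := by
      refine (Complex.abs_re_le_norm _).trans ?_
      rw [norm_mul]
      exact mul_le_mul (hν ω) (norm_inner_le_norm z m) (norm_nonneg _) hν0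
    simp only [hX]
    rw [abs_mul, abs_of_nonneg (by positivity : (0 : ℝ) ≤ 2 * s), hM]
    calc _ ≤ 2 * s * (ν * (‖z‖ * ‖m‖)) := by gcongr
      _ = _ := by ring
  have hX0 : ∫ ω, X ω ∂P = 0 := by
    have h := integral_re (hdi.mul_const (inner ℂ z m))
    simp only [RCLike.re_eq_complex_re] at h
    simp only [hX]
    rw [integral_const_mul, h, integral_mul_const, h0]
    simp
  have hexpX : ∫ ω, Real.exp (X ω) ∂P ≤ Real.exp (M ^ 2) := by
    have h := (hasSubgaussianMGF_of_mem_Icc_of_integral_eq_zero (a := -M) (b := M)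
      hXm.aemeasurable (ae_of_all P fun ω => abs_le.1 (hXM ω)) hX0).mgf_le 1
    simp only [mgf, one_mul] at h
    refine h.trans (Real.exp_le_exp.2 ?_)
    have e : ‖M - -M‖ = 2 * M := by
      rw [Real.norm_of_nonneg] <;> linarith
    push_cast
    rw [e]
    nlinarith [sq_nonneg M]
  have hpt : ∀ ω, Real.exp (s * ‖z + d ω • m‖ ^ 2) ≤ Real.exp (s * ‖z‖ ^ 2) *
      (Real.exp (X ω) + 2 * s * ‖m‖ ^ 2 * Real.exp M * ‖d ω‖ ^ 2) := by
    intro ω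
    have hsq : ‖z + d ω • m‖ ^ 2 =
        ‖z‖ ^ 2 + 2 * (d ω * inner ℂ z m).re + ‖d ω‖ ^ 2 * ‖m‖ ^ 2 := by
      rw [norm_add_sq (𝕜 := ℂ), inner_smul_right, norm_smul, mul_pow]
      rfl
    have e1 : s * ‖z + d ω • m‖ ^ 2 = s * ‖z‖ ^ 2 + (X ω + s * ‖d ω‖ ^ 2 * ‖m‖ ^ 2) := by
      rw [hsq, hX]; ring
    rw [e1, Real.exp_add, Real.exp_add]
    have ht : Real.exp (s * ‖d ω‖ ^ 2 * ‖m‖ ^ 2) ≤ 1 + 2 * (s * ‖d ω‖ ^ 2 * ‖m‖ ^ 2) := by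
      refine exp_le_one_add_two_mul (by positivity) (le_trans ?_ hsm)
      have := hν ω
      gcongr
    have hXe : Real.exp (X ω) ≤ Real.exp M := Real.exp_le_exp.2 (le_of_abs_le (hXM ω))
    refine mul_le_mul_of_nonneg_left ?_ (Real.exp_pos _).le
    calc Real.exp (X ω) * Real.exp (s * ‖d ω‖ ^ 2 * ‖m‖ ^ 2)
        ≤ Real.exp (X ω) * (1 + 2 * (s * ‖d ω‖ ^ 2 * ‖m‖ ^ 2)) :=
          mul_le_mul_of_nonneg_left ht (Real.exp_pos _).le
      _ = Real.exp (X ω) + 2 * (s * ‖d ω‖ ^ 2 * ‖m‖ ^ 2) * Real.exp (X ω) := by ring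
      _ ≤ Real.exp (X ω) + 2 * (s * ‖d ω‖ ^ 2 * ‖m‖ ^ 2) * Real.exp M := by gcongr
      _ = _ := by ring
  have hi1 : Integrable (fun ω => Real.exp (X ω)) P :=
    Integrable.of_bound (by fun_prop) (Real.exp M) (ae_of_all _ fun ω => by
      rw [Real.norm_of_nonneg (Real.exp_pos _).le]
      exact Real.exp_le_exp.2 (le_of_abs_le (hXM ω)))
  have hi2 : Integrable (fun ω => ‖d ω‖ ^ 2) P :=
    Integrable.of_bound (by fun_prop) (ν ^ 2) (ae_of_all _ fun ω => by
      rw [Real.norm_of_nonneg (by positivity)]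
      have := hν ω
      gcongr)
  have hi3 : Integrable (fun ω => Real.exp (s * ‖z‖ ^ 2) *
      (Real.exp (X ω) + 2 * s * ‖m‖ ^ 2 * Real.exp M * ‖d ω‖ ^ 2)) P :=
    (hi1.add (hi2.const_mul _)).const_mul _
  refine (integral_mono_of_nonneg (ae_of_all _ fun ω => (Real.exp_pos _).le) hi3
    (ae_of_all _ hpt)).trans ?_
  rw [integral_const_mul, integral_add hi1 (hi2.const_mul _), integral_const_mul]
  have hb : ∫ ω, Real.exp (X ω) ∂P + 2 * s * ‖m‖ ^ 2 * Real.exp M * ∫ ω, ‖d ω‖ ^ 2 ∂P ≤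
      Real.exp (M ^ 2 + 4 * s * ‖m‖ ^ 2) := by
    calc _ ≤ Real.exp (M ^ 2) + 2 * s * ‖m‖ ^ 2 * (2 * Real.exp (M ^ 2)) * 1 := by
          gcongr
          exact exp_le_two_mul_exp_sq M
      _ = Real.exp (M ^ 2) * (4 * s * ‖m‖ ^ 2 + 1) := by ring
      _ ≤ Real.exp (M ^ 2) * Real.exp (4 * s * ‖m‖ ^ 2) := by
          gcongr
          exact Real.add_one_le_exp _
      _ = _ := by rw [Real.exp_add]
  calc _ ≤ Real.exp (s * ‖z‖ ^ 2) * Real.exp (M ^ 2 + 4 * s * ‖m‖ ^ 2) := by gcongr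
    _ = _ := by
      rw [← Real.exp_add, hM]
      congr 1
      ring

variable [MeasurableSpace V] [BorelSpace V] [SecondCountableTopology V]

/-- Exponential square moment of `∑ j, d j • m j`, where the `d j` are independent, centred,
bounded by `ν` and of variance at most `1`. The parameter `s` moves along the induction, below
the threshold `σ`. -/
theorem integral_exp_norm_sum_smul_sq_le {κ : Type*} {d : κ → Ω → ℂ} {ν : ℝ}
    (hd : ∀ j, Measurable (d j)) (hi : iIndepFun d P) (hν : ∀ j ω, ‖d j ω‖ ≤ ν)
    (h0 : ∀ j, ∫ ω, d j ω ∂P = 0) (h1 : ∀ j, ∫ ω, ‖d j ω‖ ^ 2 ∂P ≤ 1) (m : κ → V) {σ : ℝ}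
    (hσ0 : 0 ≤ σ) (T : Finset κ) (hσ : 8 * ν ^ 2 * σ * ∑ j ∈ T, ‖m j‖ ^ 2 ≤ 1) {s : ℝ} (hs : 0 ≤ s)
    (hsσ : s * (1 + 8 * ν ^ 2 * σ * ∑ j ∈ T, ‖m j‖ ^ 2) ≤ σ) :
    ∫ ω, Real.exp (s * ‖∑ j ∈ T, d j ω • m j‖ ^ 2) ∂P ≤
      Real.exp (4 * σ * ∑ j ∈ T, ‖m j‖ ^ 2) := by
  classical
  induction T using Finset.induction_on generalizing s with
  | empty => simp
  | insert j T hj ih =>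
    set q := ‖m j‖ ^ 2 with hq
    set A := ∑ i ∈ T, ‖m i‖ ^ 2 with hA
    have hq0 : 0 ≤ q := by positivity
    have hA0 : 0 ≤ A := Finset.sum_nonneg fun i _ => by positivity
    rw [Finset.sum_insert hj, ← hq, ← hA] at hσ hsσ ⊢
    have hN0 : 0 ≤ ν ^ 2 := sq_nonneg ν
    have hsle : s ≤ σ := by
      refine le_trans ?_ hsσ
      have : 0 ≤ s * (8 * ν ^ 2 * σ * (q + A)) := by positivity
      linarith
    -- integrating out `d j` replaces `s` by `s'`
    set s' := s * (1 + 4 * s * ν ^ 2 * q) with hs'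
    have hs'0 : 0 ≤ s' := by positivity
    have hσA : 8 * ν ^ 2 * σ * A ≤ 1 := by
      have : 0 ≤ 8 * ν ^ 2 * σ * q := by positivity
      linarith
    have hs's : s' * (1 + 8 * ν ^ 2 * σ * A) ≤ σ := by
      refine le_trans ?_ hsσ
      have e1 : 4 * s * ν ^ 2 * q ≤ 4 * σ * ν ^ 2 * q := by gcongr
      have e2 : 4 * s * ν ^ 2 * q * (1 + 8 * ν ^ 2 * σ * A) ≤ 4 * σ * ν ^ 2 * q * 2 := by
        have : 0 ≤ 8 * ν ^ 2 * σ * A := by positivity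
        gcongr
        linarith
      calc s' * (1 + 8 * ν ^ 2 * σ * A) =
          s * (1 + 8 * ν ^ 2 * σ * A + 4 * s * ν ^ 2 * q * (1 + 8 * ν ^ 2 * σ * A)) := by
            rw [hs']; ring
        _ ≤ s * (1 + 8 * ν ^ 2 * σ * A + 4 * σ * ν ^ 2 * q * 2) := by gcongr
        _ = _ := by ring
    have hih := ih hσA hs'0 hs's
    have hsq : s * ν ^ 2 * q ≤ 1 / 2 := by
      have e1 : s * ν ^ 2 * q ≤ σ * ν ^ 2 * q := by gcongr
      have e2 : 0 ≤ 8 * ν ^ 2 * σ * A := by positivity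
      have e3 : 0 ≤ σ * ν ^ 2 * q := by positivity
      linarith
    have hterm : ∀ i, Measurable (fun ω => d i ω • m i) := fun i => (hd i).smul_const _
    have hWm : Measurable (fun ω => ∑ i ∈ T, d i ω • m i) :=
      Finset.measurable_sum _ fun i _ => hterm i
    have hWb : ∀ ω, ‖∑ i ∈ T, d i ω • m i‖ ≤ ∑ i ∈ T, ν * ‖m i‖ := fun ω =>
      norm_sum_le_of_le _ fun i _ => by
        rw [norm_smul]
        exact mul_le_mul_of_nonneg_right (hν i ω) (norm_nonneg _)
    have hind : IndepFun (fun ω => ∑ i ∈ T, d i ω • m i) (d j) P := by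
      have h := hi.indepFun_finset T {j} (by simpa using hj) hd
      have hφ : Measurable (fun v : T → ℂ => ∑ i : T, v i • m i) :=
        Finset.measurable_sum _ fun i _ => (measurable_pi_apply i).smul_const _
      have hψ : Measurable (fun v : ({j} : Finset κ) → ℂ => v ⟨j, Finset.mem_singleton_self j⟩) :=
        measurable_pi_apply _
      have h2 := h.comp hφ hψ
      convert h2 using 1
      · funext ω
        exact (Finset.sum_coe_sort T (fun i => d i ω • m i)).symm
      · rfl
    have hfub := integral_indepFun_eq (P := P) hWm (hd j) hind
      (f := fun p : V × ℂ => Real.exp (s * ‖p.1 + p.2 • m j‖ ^ 2)) (by fun_prop) (by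
        refine integrable_exp_norm_sq (hWm.add (hterm j)) (C := ∑ i ∈ T, ν * ‖m i‖ + ν * ‖m j‖)
          (fun ω => ?_) hs
        refine (norm_add_le _ _).trans (add_le_add (hWb ω) ?_)
        rw [norm_smul]
        exact mul_le_mul_of_nonneg_right (hν j ω) (norm_nonneg _))
    have hrw : ∀ ω, Real.exp (s * ‖∑ i ∈ insert j T, d i ω • m i‖ ^ 2) =
        Real.exp (s * ‖∑ i ∈ T, d i ω • m i + d j ω • m j‖ ^ 2) := by
      intro ω
      rw [Finset.sum_insert hj, add_comm]
    simp only [hrw]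
    refine hfub.le.trans ?_
    refine (integral_mono_of_nonneg
      (g := fun ω => Real.exp (4 * s * q) * Real.exp (s' * ‖∑ i ∈ T, d i ω • m i‖ ^ 2))
      (ae_of_all _ fun ω => integral_nonneg fun ω' => (Real.exp_pos _).le)
      ((integrable_exp_norm_sq hWm hWb hs'0).const_mul _) (ae_of_all _ fun ω => ?_)).trans ?_
    · refine (integral_exp_norm_add_smul_sq_le (hd j) (hν j) (h0 j) (h1 j)
        (∑ i ∈ T, d i ω • m i) (m j) hs hsq).trans_eq ?_
      rw [add_comm, Real.exp_add]
    · rw [integral_const_mul]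
      calc _ ≤ Real.exp (4 * s * q) * Real.exp (4 * σ * A) := by gcongr
        _ ≤ Real.exp (4 * σ * q) * Real.exp (4 * σ * A) := by gcongr
        _ = _ := by rw [← Real.exp_add]; congr 1; ring

/-- Upper tail of `∑ l, ‖∑ j, d (l, j) • m j‖ ^ 2` for independent, centred coefficients bounded
by `ν` and of variance at most `1`. -/
theorem measure_sum_norm_sq_ge_le {κ : Type*} [Fintype κ] {L : ℕ} {d : Fin L × κ → Ω → ℂ} {ν : ℝ}
    (hd : ∀ j, Measurable (d j)) (hi : iIndepFun d P) (hν : ∀ j ω, ‖d j ω‖ ≤ ν) (hν0 : 0 < ν)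
    (h0 : ∀ j, ∫ ω, d j ω ∂P = 0) (h1 : ∀ j, ∫ ω, ‖d j ω‖ ^ 2 ∂P ≤ 1) (m : κ → V) {ε : ℝ}
    (hε : 0 < ε) (hm : ∑ j, ‖m j‖ ^ 2 ≤ ε ^ 2) :
    P.real {ω | 10 * ε ^ 2 * L ≤ ∑ l, ‖∑ j, d (l, j) ω • m j‖ ^ 2} ≤
      Real.exp (-(L / (8 * ν ^ 2))) := by
  set σ : ℝ := 1 / (8 * ν ^ 2 * ε ^ 2) with hσ
  have hσ0 : 0 < σ := by positivity
  have hσe : 8 * ν ^ 2 * σ * ε ^ 2 = 1 := by rw [hσ]; field_simp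
  have hσm : 8 * ν ^ 2 * σ * ∑ j, ‖m j‖ ^ 2 ≤ 1 := by
    rw [← hσe]; gcongr
  have hW : ∀ l, Measurable (fun ω => ∑ j, d (l, j) ω • m j) := fun l =>
    Finset.measurable_sum _ fun j _ => (hd _).smul_const _
  have hWb : ∀ l ω, ‖∑ j, d (l, j) ω • m j‖ ≤ ∑ j, ν * ‖m j‖ := fun l ω =>
    norm_sum_le_of_le _ fun j _ => by
      rw [norm_smul]
      exact mul_le_mul_of_nonneg_right (hν _ ω) (norm_nonneg _)
  have hmgf : ∀ l, mgf (fun ω => ‖∑ j, d (l, j) ω • m j‖ ^ 2) P (σ / 2) ≤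
      Real.exp (4 * σ * ε ^ 2) := by
    intro l
    refine (integral_exp_norm_sum_smul_sq_le (P := P) (d := fun j => d (l, j)) (fun j => hd _)
      (hi.precomp (Prod.mk_right_injective l)) (fun j => hν _) (fun j => h0 _) (fun j => h1 _) m
      hσ0.le Finset.univ hσm (s := σ / 2) (by positivity) ?_).trans ?_
    · nlinarith
    · gcongr
  have hind : iIndepFun (fun l ω => ‖∑ j, d (l, j) ω • m j‖ ^ 2) P :=
    (iIndepFun_blocks hi hd).comp (fun _ v => ‖∑ j, v j • m j‖ ^ 2) fun _ =>
      (Finset.measurable_sum _ fun j _ => (measurable_pi_apply j).smul_const _).norm.pow_const 2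
  have hsum := hind.mgf_sum (t := σ / 2) (fun l => (hW l).norm.pow_const 2) Finset.univ
  have hmk := measure_ge_le_exp_mul_mgf (μ := P) (t := σ / 2)
    (X := ∑ l, fun ω => ‖∑ j, d (l, j) ω • m j‖ ^ 2) (10 * ε ^ 2 * L) (by positivity) (by
      refine Integrable.of_bound ?_
        (Real.exp (σ / 2 * ∑ _l : Fin L, (∑ j, ν * ‖m j‖) ^ 2)) (ae_of_all _ fun ω => ?_)
      · simp only [Finset.sum_apply]
        exact (((Finset.measurable_sum _ fun l _ => (hW l).norm.pow_const 2).const_mul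
          _).exp).aestronglyMeasurable
      · rw [Real.norm_of_nonneg (Real.exp_pos _).le, Finset.sum_apply]
        have := hWb
        gcongr with l
        exact this l ω)
  simp only [Finset.sum_apply] at hmk
  refine hmk.trans ?_
  rw [hsum]
  calc _ ≤ Real.exp (-(σ / 2) * (10 * ε ^ 2 * L)) * ∏ _l : Fin L, Real.exp (4 * σ * ε ^ 2) := by
        gcongr with l
        · exact fun l _ => mgf_nonneg
        · exact hmgf l
    _ = Real.exp (-(L / (8 * ν ^ 2))) := by
        rw [Finset.prod_const, Finset.card_univ, Fintype.card_fin, ← Real.exp_nat_mul,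
          ← Real.exp_add]
        congr 1
        rw [hσ]
        field_simp
        ring

end SquareExp

/-! ### The LASSO estimate for fixed data -/

section Lasso

variable {n L : ℕ}

/-- The linear map `w ↦ h ⊛ (d ⊙ w)`. -/
noncomputable def maskedConv (h d : EuclideanSpace ℂ (Fin n)) :
    EuclideanSpace ℂ (Fin n) →ₗ[ℂ] EuclideanSpace ℂ (Fin n) where
  toFun w := circConv h (hadamard d w)
  map_add' v w := by
    ext i
    simp [circConv_apply, hadamard, mul_add, Finset.sum_add_distrib]
  map_smul' c w := by
    ext i
    simp only [circConv_apply, hadamard, PiLp.smul_apply, smul_eq_mul, RingHom.id_apply,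
      Finset.mul_sum]
    exact Finset.sum_congr rfl fun j _ => by ring

theorem maskedConv_apply (h d w : EuclideanSpace ℂ (Fin n)) :
    maskedConv h d w = circConv h (hadamard d w) := rfl

theorem oneNorm_nonneg (w : EuclideanSpace ℂ (Fin n)) : 0 ≤ oneNorm w :=
  Finset.sum_nonneg fun _ _ => norm_nonneg _

theorem norm_le_oneNorm (w : EuclideanSpace ℂ (Fin n)) : ‖w‖ ≤ oneNorm w := by
  rw [EuclideanSpace.norm_eq]
  exact Real.sqrt_le_iff.2 ⟨oneNorm_nonneg w,
    Finset.sum_sq_le_sq_sum_of_nonneg fun _ _ => norm_nonneg _⟩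

theorem exists_isLassoSolution (h₀ : EuclideanSpace ℂ (Fin n))
    (d y : Fin L → EuclideanSpace ℂ (Fin n)) {lam : ℝ} (hlam : 0 < lam) :
    ∃ xs, IsLassoSolution h₀ d y lam xs := by
  have hc : Continuous (lassoObjective h₀ d y lam) := by
    have h1 : ∀ l, Continuous (fun w => circConv h₀ (hadamard (d l) w)) := fun l =>
      (maskedConv h₀ (d l)).continuous_of_finiteDimensional
    unfold lassoObjective oneNorm
    fun_prop
  refine hc.exists_forall_le (Filter.tendsto_atTop_mono (fun w => ?_)
    ((tendsto_norm_cocompact_atTop (E := EuclideanSpace ℂ (Fin n))).const_mul_atTop hlam))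
  have h1 := mul_le_mul_of_nonneg_left (norm_le_oneNorm w) hlam.le
  have h2 : 0 ≤ 1 / (2 * (L : ℝ)) * ∑ l, ‖circConv h₀ (hadamard (d l) w) - y l‖ ^ 2 := by
    positivity
  rw [lassoObjective]
  linarith

theorem sum_norm_le_sqrt_mul_norm {S : Finset (Fin n)} {k : ℕ} (hS : S.card ≤ k)
    (w : EuclideanSpace ℂ (Fin n)) : ∑ i ∈ S, ‖w i‖ ≤ Real.sqrt k * ‖w‖ := by
  refine (Real.le_sqrt_of_sq_le (y := k * ‖w‖ ^ 2) ?_).trans_eq ?_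
  · refine (sq_sum_le_card_mul_sum_sq (s := S) (f := fun i => ‖w i‖)).trans ?_
    rw [EuclideanSpace.norm_sq_eq]
    have h1 : ∑ i ∈ S, ‖w i‖ ^ 2 ≤ ∑ i, ‖w i‖ ^ 2 :=
      Finset.sum_le_sum_of_subset_of_nonneg (Finset.subset_univ S) fun _ _ _ => by positivity
    gcongr
  · rw [Real.sqrt_mul (by positivity), Real.sqrt_sq (norm_nonneg _)]

theorem oneNorm_sub_oneNorm_add_le {S : Finset (Fin n)} {k : ℕ} (hS : S.card ≤ k)
    (x w : EuclideanSpace ℂ (Fin n)) :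
    oneNorm x - oneNorm (x + w) ≤ Real.sqrt k * ‖w‖ + 2 * ∑ i ∈ Sᶜ, ‖x i‖ := by
  have h1 := sum_norm_le_sqrt_mul_norm hS w
  have h2 : ∑ i ∈ S, (‖x i‖ - ‖x i + w i‖) ≤ ∑ i ∈ S, ‖w i‖ :=
    Finset.sum_le_sum fun i _ => by
      have := norm_sub_le (x i + w i) (w i)
      rw [add_sub_cancel_right] at this
      linarith
  have h3 : ∑ i ∈ Sᶜ, (‖x i‖ - ‖x i + w i‖) ≤ 2 * ∑ i ∈ Sᶜ, ‖x i‖ := by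
    rw [Finset.mul_sum]
    exact Finset.sum_le_sum fun i _ => by linarith [norm_nonneg (x i + w i), norm_nonneg (x i)]
  have h4 : oneNorm x - oneNorm (x + w) = ∑ i ∈ S, (‖x i‖ - ‖x i + w i‖) +
      ∑ i ∈ Sᶜ, (‖x i‖ - ‖x i + w i‖) := by
    rw [Finset.sum_add_sum_compl, Finset.sum_sub_distrib]
    rfl
  linarith

/-- The error of a LASSO solution when the stacked measurement map is bounded below. Since it is
bounded below on the whole space, neither a cone condition nor a bound in the dual norm on the noise
is needed. -/
theorem norm_lassoSolution_sub_le (hL : 0 < L) {h₀ : EuclideanSpace ℂ (Fin n)}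
    {d y : Fin L → EuclideanSpace ℂ (Fin n)} {lam : ℝ} (hlam : 0 < lam)
    {x xs : EuclideanSpace ℂ (Fin n)} (hxs : IsLassoSolution h₀ d y lam xs)
    (hlow : ∀ w, L / 6 * ‖w‖ ^ 2 ≤ ∑ l, ‖maskedConv h₀ (d l) w‖ ^ 2)
    (hnoise : ∑ l, ‖y l - maskedConv h₀ (d l) x‖ ^ 2 ≤ 2 * L * lam ^ 2)
    {S : Finset (Fin n)} {k : ℕ} (hk : 1 ≤ k) (hS : S.card ≤ k) :
    ‖xs - x‖ ≤ 50 * Real.sqrt k * lam + (∑ i ∈ Sᶜ, ‖x i‖) / Real.sqrt k := by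
  have hL' : (0 : ℝ) < L := by exact_mod_cast hL
  set w := xs - x with hw
  have hxw : xs = x + w := by rw [hw]; abel
  have hopt := hxs x
  simp only [lassoObjective, ← maskedConv_apply] at hopt
  -- expand the fidelity term at `x + w` and absorb the cross term, `2 ‖a‖ ‖b‖ ≤ ‖a‖² / 2 + 2 ‖b‖²`
  have hpt : ∀ l, 1 / 2 * ‖maskedConv h₀ (d l) w‖ ^ 2 ≤ ‖maskedConv h₀ (d l) xs - y l‖ ^ 2
      - ‖maskedConv h₀ (d l) x - y l‖ ^ 2 + 2 * ‖y l - maskedConv h₀ (d l) x‖ ^ 2 := by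
    intro l
    set a := maskedConv h₀ (d l) w
    set b := y l - maskedConv h₀ (d l) x with hb
    have e1 : maskedConv h₀ (d l) xs - y l = a - b := by
      rw [hxw, map_add, hb]; abel
    have e2 : ‖maskedConv h₀ (d l) x - y l‖ = ‖b‖ := norm_sub_rev _ _
    rw [e1, e2, norm_sub_sq (𝕜 := ℂ)]
    have h1 := re_inner_le_norm (𝕜 := ℂ) a b
    nlinarith [sq_nonneg (‖a‖ - 2 * ‖b‖)]
  have hsum := Finset.sum_le_sum fun l (_ : l ∈ Finset.univ) => hpt l
  rw [Finset.sum_add_distrib, Finset.sum_sub_distrib, ← Finset.mul_sum, ← Finset.mul_sum] at hsum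
  have hlw := hlow w
  have hone := oneNorm_sub_oneNorm_add_le hS x w
  rw [← hxw] at hone
  set σ := ∑ i ∈ Sᶜ, ‖x i‖
  have hσ : 0 ≤ σ := Finset.sum_nonneg fun _ _ => norm_nonneg _
  set F := ∑ l, ‖maskedConv h₀ (d l) xs - y l‖ ^ 2
  set G := ∑ l, ‖maskedConv h₀ (d l) x - y l‖ ^ 2
  have hFG : F - G ≤ 2 * L * (lam * (Real.sqrt k * ‖w‖ + 2 * σ)) := by
    have e : ∀ t : ℝ, t = 2 * L * (1 / (2 * L) * t) := fun t => by field_simp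
    rw [e F, e G, ← mul_sub]
    refine mul_le_mul_of_nonneg_left ?_ (by positivity)
    have := mul_le_mul_of_nonneg_left hone hlam.le
    linarith
  set r := Real.sqrt k with hr
  have hr1 : 1 ≤ r := by
    rw [hr, Real.one_le_sqrt]
    exact_mod_cast hk
  have hmain : ‖w‖ ^ 2 ≤ 48 * lam ^ 2 + 24 * (r * lam) * ‖w‖ + 48 * lam * σ := by
    refine le_of_mul_le_mul_left ?_ hL'
    linarith
  set τ := σ / r with hτ
  have hτ0 : 0 ≤ τ := by positivity
  have hστ : σ = r * τ := by rw [hτ]; field_simp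
  set s := r * lam with hs
  have hsl : lam ≤ s := by nlinarith
  have hs0 : 0 < s := by positivity
  have hmain2 : ‖w‖ ^ 2 ≤ 48 * s ^ 2 + 24 * s * ‖w‖ + 48 * (s * τ) := by
    have e : 48 * lam * σ = 48 * (s * τ) := by rw [hστ, hs]; ring
    rw [← e]
    have : lam ^ 2 ≤ s ^ 2 := by gcongr
    linarith
  rw [mul_assoc, ← hs]
  by_contra! hc
  nlinarith [mul_pos (sub_pos.2 hc) hs0, mul_nonneg (sub_pos.2 hc).le hτ0,
    mul_nonneg hs0.le hτ0, sq_nonneg τ, mul_pos hs0 hs0, sq_nonneg (‖w‖ - (50 * s + τ))]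

end Lasso

/-! ### The random Gram matrices -/

section Gram

open scoped Matrix ComplexOrder

variable {n L : ℕ}

/-- The matrix of `w ↦ h ⊛ (v ⊙ w)`. -/
def maskedConvMatrix (h v : Fin n → ℂ) : Matrix (Fin n) (Fin n) ℂ :=
  Matrix.circulant h * Matrix.diagonal v

theorem maskedConvMatrix_mulVec (h v w : Fin n → ℂ) : maskedConvMatrix h v *ᵥ w =
    (maskedConv (WithLp.toLp 2 h) (WithLp.toLp 2 v) (WithLp.toLp 2 w)).ofLp := by
  rw [maskedConvMatrix, ← Matrix.mulVec_mulVec]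
  simp only [maskedConv_apply, circConv, hadamard]
  congr 1
  ext i
  rw [Matrix.mulVec_diagonal]

theorem dotProduct_gram_mulVec (h v w : Fin n → ℂ) :
    star w ⬝ᵥ (((maskedConvMatrix h v)ᴴ * maskedConvMatrix h v) *ᵥ w) =
      ((‖maskedConv (WithLp.toLp 2 h) (WithLp.toLp 2 v) (WithLp.toLp 2 w)‖ ^ 2 : ℝ) : ℂ) := by
  rw [← Matrix.mulVec_mulVec, Matrix.dotProduct_mulVec, Matrix.vecMul_conjTranspose, star_star,
    maskedConvMatrix_mulVec, EuclideanSpace.norm_sq_eq]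
  simp only [dotProduct, Pi.star_apply, Complex.star_def, Complex.conj_mul']
  push_cast
  rfl

theorem dotProduct_self_eq (w : Fin n → ℂ) :
    star w ⬝ᵥ w = ((‖WithLp.toLp 2 w‖ ^ 2 : ℝ) : ℂ) := by
  rw [EuclideanSpace.norm_sq_eq]
  simp only [dotProduct, Pi.star_apply, Complex.star_def, Complex.conj_mul']
  push_cast
  rfl

theorem gram_apply (h v : Fin n → ℂ) (i j : Fin n) :
    ((maskedConvMatrix h v)ᴴ * maskedConvMatrix h v) i j =
      (star (v i) * v j) * ∑ k, star (h (k - i)) * h (k - j) := by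
  simp only [maskedConvMatrix, Matrix.mul_apply (M := (Matrix.circulant h * Matrix.diagonal v)ᴴ),
    Matrix.conjTranspose_apply, Matrix.mul_diagonal, Matrix.circulant_apply, Finset.mul_sum,
    star_mul]
  exact Finset.sum_congr rfl fun k _ => by ring

theorem norm_maskedConv_sq_le (h v w : EuclideanSpace ℂ (Fin n)) {ν : ℝ} (hv : ∀ i, ‖v i‖ ≤ ν) :
    ‖maskedConv h v w‖ ^ 2 ≤ supNorm (dft h) ^ 2 * ν ^ 2 * ‖w‖ ^ 2 := by
  refine (norm_circConv_sq_le h (hadamard v w)).trans ?_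
  rw [mul_assoc]
  refine mul_le_mul_of_nonneg_left ?_ (sq_nonneg _)
  rw [EuclideanSpace.norm_sq_eq, EuclideanSpace.norm_sq_eq, Finset.mul_sum]
  refine Finset.sum_le_sum fun i _ => ?_
  rw [hadamard, norm_mul, mul_pow]
  have := hv i
  gcongr

theorem sum_norm_sq_shift (h : EuclideanSpace ℂ (Fin n)) (i : Fin n) :
    ∑ k, ‖h (k - i)‖ ^ 2 = ‖h‖ ^ 2 := by
  have : NeZero n := ⟨by rintro rfl; exact i.elim0⟩
  rw [EuclideanSpace.norm_sq_eq]
  exact Equiv.sum_comp (Equiv.subRight i) (fun k => ‖h k‖ ^ 2)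

variable {Ω : Type*} [MeasurableSpace Ω] {P : Measure Ω} [IsProbabilityMeasure P]

/-- The stacked random measurement map `w ↦ (h ⊛ (d l ⊙ w))_l` is bounded below on the whole space
outside an event of exponentially small probability. -/
theorem measure_exists_sum_norm_maskedConv_lt_le {d : Fin L × Fin n → Ω → ℂ} {ν R : ℝ}
    (hd : ∀ p, Measurable (d p)) (hi : iIndepFun d P) (hν : ∀ p ω, ‖d p ω‖ ≤ ν) (hν0 : 0 ≤ ν)
    (h0 : ∀ p, ∫ ω, d p ω ∂P = 0) (h1 : ∀ p, ∫ ω, ‖d p ω‖ ^ 2 ∂P = 1)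
    {h : EuclideanSpace ℂ (Fin n)} (hh : ‖h‖ = 1) (hR1 : 1 ≤ R)
    (hR : supNorm (dft h) ^ 2 * ν ^ 2 ≤ R) :
    P.real {ω | ∃ w, ∑ l, ‖maskedConv h (WithLp.toLp 2 fun j => d (l, j) ω) w‖ ^ 2 <
      L / 6 * ‖w‖ ^ 2} ≤ n * Real.exp (-(L / (12 * R))) := by
  set p : ℝ := 1 / (2 * R) with hp
  have hp0 : 0 < p := by positivity
  have hp3 : p ≤ 3 := by
    rw [hp, div_le_iff₀ (by positivity)]
    linarith
  have hpR : p * R = 1 / 2 := by rw [hp]; field_simp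
  -- the normalized Gram matrix as a function of the mask
  set φ : (Fin n → ℂ) → Fin n → Fin n → ℂ := fun v i j =>
    p * ((star (v i) * v j) * ∑ k, star (h (k - i)) * h (k - j)) with hφ
  have hφc : Continuous φ := by
    simp only [hφ]
    fun_prop
  have hφm : ∀ v, (Matrix.of (φ v) : Matrix (Fin n) (Fin n) ℂ) =
      (p : ℂ) • ((maskedConvMatrix h.ofLp v)ᴴ * maskedConvMatrix h.ofLp v) := by
    intro v
    ext i j
    rw [Matrix.smul_apply, gram_apply, smul_eq_mul]
    rfl
  have hblock : ∀ l, Measurable (fun ω (j : Fin n) => d (l, j) ω) := fun l =>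
    measurable_pi_iff.2 fun j => hd _
  obtain ⟨C, hC⟩ := (isCompact_closedBall (0 : Fin n → ℂ) ν).exists_bound_of_continuousOn
    hφc.continuousOn
  set Y : Fin L → Ω → Fin n → Fin n → ℂ := fun l ω => φ (fun j => d (l, j) ω) with hY
  have hYm : ∀ l, Measurable (Y l) := fun l => hφc.measurable.comp (hblock l)
  have hYi : iIndepFun Y P := (iIndepFun_blocks hi hd).comp (fun _ => φ) fun _ => hφc.measurable
  have hpos : ∀ l ω, (Matrix.of (Y l ω)).PosSemidef := by
    intro l ω
    rw [hY, hφm]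
    exact (Matrix.posSemidef_conjTranspose_mul_self _).smul (by exact_mod_cast hp0.le)
  have hle : ∀ l ω, ((1 / 2 : ℂ) • (1 : Matrix (Fin n) (Fin n) ℂ) -
      Matrix.of (Y l ω)).PosSemidef := by
    intro l ω
    refine Matrix.PosSemidef.of_dotProduct_mulVec_nonneg ?_ fun w => ?_
    · refine Matrix.IsHermitian.sub ?_ (hpos l ω).isHermitian
      ext i j
      by_cases hij : i = j
      · subst hij; simp
      · simp [hij, Ne.symm hij]
    · rw [Matrix.sub_mulVec, dotProduct_sub, Matrix.smul_mulVec, Matrix.one_mulVec,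
        dotProduct_smul, dotProduct_self_eq, hY, hφm, Matrix.smul_mulVec, dotProduct_smul,
        dotProduct_gram_mulVec]
      have hb := norm_maskedConv_sq_le h (WithLp.toLp 2 fun j => d (l, j) ω) (WithLp.toLp 2 w)
        (fun j => hν (l, j) ω)
      have hb2 : p * ‖maskedConv h (WithLp.toLp 2 fun j => d (l, j) ω) (WithLp.toLp 2 w)‖ ^ 2 ≤
          1 / 2 * ‖(WithLp.toLp 2 w : EuclideanSpace ℂ (Fin n))‖ ^ 2 := by
        rw [← hpR, mul_assoc]
        refine mul_le_mul_of_nonneg_left (hb.trans ?_) hp0.le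
        gcongr
      have hb3 := sub_nonneg.2 hb2
      set a := ‖(WithLp.toLp 2 w : EuclideanSpace ℂ (Fin n))‖ ^ 2
      set b := ‖maskedConv h (WithLp.toLp 2 fun j => d (l, j) ω) (WithLp.toLp 2 w)‖ ^ 2
      have e : (1 / 2 : ℂ) * (a : ℂ) - (p : ℂ) * (b : ℂ) = ((1 / 2 * a - p * b : ℝ) : ℂ) := by
        push_cast
        ring
      exact (Complex.zero_le_real.2 hb3).trans_eq e.symm
  have hYC : ∀ l ω, ‖Y l ω‖ ≤ C := fun l ω =>
    hC _ (by simpa using (pi_norm_le_iff_of_nonneg hν0).2 fun j => hν (l, j) ω)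
  have hE : ∀ l i j, ∫ ω, Y l ω i j ∂P = if i = j then (p : ℂ) else 0 := by
    intro l i j
    simp only [hY, hφ]
    rw [integral_const_mul, integral_mul_const]
    split_ifs with hij
    · subst hij
      have e1 : ∫ ω, star (d (l, i) ω) * d (l, i) ω ∂P = 1 := by
        have e2 : ∀ ω, star (d (l, i) ω) * d (l, i) ω = ((‖d (l, i) ω‖ ^ 2 : ℝ) : ℂ) := by
          intro ω
          rw [Complex.star_def, Complex.conj_mul']
          push_cast
          rfl
        simp only [e2]
        rw [integral_complex_ofReal, h1]
        rfl
      have e3 : ∑ k, star (h (k - i)) * h (k - i) = 1 := by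
        have e4 : ∑ k, ‖h (k - i)‖ ^ 2 = 1 := by
          rw [sum_norm_sq_shift, hh, one_pow]
        simp only [Complex.star_def, Complex.conj_mul']
        exact_mod_cast e4
      rw [e1, e3, mul_one, mul_one]
    · have hind : IndepFun (fun ω => star (d (l, i) ω)) (d (l, j)) P :=
        (hi.indepFun (i := (l, i)) (j := (l, j)) (by simpa using hij)).comp (φ := star)
          (ψ := id) continuous_star.measurable measurable_id
      rw [hind.integral_fun_mul_eq_mul_integral
        (continuous_star.measurable.comp (hd _)).aestronglyMeasurable
        (hd _).aestronglyMeasurable, h0]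
      simp
  have hmain := measure_not_posSemidef_le hYm hYi hpos hle hYC hp3 hE Finset.univ
  rw [Finset.card_univ, Fintype.card_fin, Fintype.card_fin] at hmain
  have e1 : (L : ℝ) * p / 6 = L / (12 * R) := by
    rw [hp]
    field_simp
    ring
  refine (measureReal_mono ?_).trans (hmain.trans_eq (by rw [e1]))
  rintro ω ⟨w, hw⟩ hps
  have h2 := hps.dotProduct_mulVec_nonneg w.ofLp
  have e2 : (Matrix.of (∑ l, Y l ω) : Matrix (Fin n) (Fin n) ℂ) = ∑ l, Matrix.of (Y l ω) :=
    map_sum Matrix.ofAddEquiv _ _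
  rw [e2, Matrix.sub_mulVec, dotProduct_sub, Matrix.smul_mulVec, Matrix.one_mulVec,
    dotProduct_smul, dotProduct_self_eq, Matrix.sum_mulVec, dotProduct_sum] at h2
  simp only [hY, hφm, Matrix.smul_mulVec, dotProduct_smul, dotProduct_gram_mulVec, smul_eq_mul]
    at h2
  have h3 : 0 ≤ ∑ l, p * ‖maskedConv h (WithLp.toLp 2 fun j => d (l, j) ω) w‖ ^ 2 -
      L * p / 6 * ‖w‖ ^ 2 := by exact_mod_cast h2
  rw [← Finset.mul_sum] at h3
  nlinarith [mul_lt_mul_of_pos_left hw hp0]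

/-- The columns of `v ↦ e ⊛ (v ⊙ x)`. -/
theorem maskedConv_eq_sum (e x v : EuclideanSpace ℂ (Fin n)) :
    maskedConv e v x = ∑ j, v j • (WithLp.toLp 2 fun i => e (i - j) * x j) := by
  ext i
  rw [maskedConv_apply, circConv_apply, WithLp.ofLp_sum, Finset.sum_apply]
  refine Finset.sum_congr rfl fun j _ => ?_
  simp only [hadamard, PiLp.smul_apply, smul_eq_mul]
  ring

theorem sum_norm_sq_column (e x : EuclideanSpace ℂ (Fin n)) :
    ∑ j, ‖(WithLp.toLp 2 fun i => e (i - j) * x j : EuclideanSpace ℂ (Fin n))‖ ^ 2 =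
      ‖e‖ ^ 2 * ‖x‖ ^ 2 := by
  rw [EuclideanSpace.norm_sq_eq x, Finset.mul_sum]
  refine Finset.sum_congr rfl fun j _ => ?_
  rw [EuclideanSpace.norm_sq_eq]
  simp only [norm_mul, mul_pow]
  rw [← Finset.sum_mul, sum_norm_sq_shift]

end Gram

/-! ### The masks -/

/-- Masks whose entries are independent copies of a bounded variable agree almost surely with
masks that are everywhere measurable and bounded. -/
theorem exists_bounded_measurable_masks {Ω Ω' : Type*} [MeasurableSpace Ω] [MeasurableSpace Ω']
    {P : Measure Ω} {Q : Measure Ω'} {n L : ℕ}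
    {g : Ω' → ℂ} {ν : ℝ} {d : Fin L → Ω → EuclideanSpace ℂ (Fin n)}
    (hg : IsMaskVariable Q g ν) (hd : AreIndepCopies P d Q g) :
    ∃ d' : Fin L × Fin n → Ω → ℂ, (∀ p, Measurable (d' p)) ∧ iIndepFun d' P ∧
      (∀ p ω, ‖d' p ω‖ ≤ ν) ∧ (∀ p, ∫ ω, d' p ω ∂P = 0) ∧ (∀ p, ∫ ω, ‖d' p ω‖ ^ 2 ∂P = 1) ∧
      ∀ᵐ ω ∂P, ∀ p : Fin L × Fin n, d' p ω = d p.1 ω p.2 := by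
  have hid : ∀ p : Fin L × Fin n, IdentDistrib (fun ω => d p.1 ω p.2) g P Q :=
    fun p => hd.identDistrib p.1 p.2
  set d' : Fin L × Fin n → Ω → ℂ := fun p ω =>
    if ‖(hid p).aemeasurable_fst.mk _ ω‖ ≤ ν then (hid p).aemeasurable_fst.mk _ ω else 0
  have hae : ∀ p, (fun ω => d p.1 ω p.2) =ᵐ[P] d' p := by
    intro p
    have hb : ∀ᵐ ω ∂P, ‖d p.1 ω p.2‖ ≤ ν :=
      (hid p).symm.ae_mem_snd (t := {z : ℂ | ‖z‖ ≤ ν})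
        (measurableSet_le measurable_norm measurable_const) hg.norm_le
    filter_upwards [hb, (hid p).aemeasurable_fst.ae_eq_mk] with ω h1 h2
    simp only [d']
    rw [← h2, if_pos h1]
  refine ⟨d', fun p => ?_, hd.indep.congr hae, fun p ω => ?_, fun p => ?_, fun p => ?_, ?_⟩
  · have hm := (hid p).aemeasurable_fst.measurable_mk
    exact Measurable.ite (measurableSet_le hm.norm measurable_const) hm measurable_const
  · simp only [d']
    split_ifs with h
    · exact h
    · rw [norm_zero]
      exact zero_le_one.trans hg.one_le
  · rw [← integral_congr_ae (hae p), (hid p).integral_eq, hg.mean_zero]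
  · have h1 : ∫ ω, ‖d' p ω‖ ^ 2 ∂P = ∫ ω, ‖d p.1 ω p.2‖ ^ 2 ∂P :=
      integral_congr_ae ((hae p).mono fun ω h => by simp only [h])
    have h2 := ((hid p).comp (u := fun z : ℂ => ‖z‖ ^ 2) (by fun_prop)).integral_eq
    rw [h1]
    exact h2.trans hg.second_moment
  · rw [ae_all_iff]
    exact fun p => (hae p).mono fun ω h => h.symm

/-! ### Recovery guarantee -/

section Recovery

variable {n L : ℕ}

/-- The residual of the rescaled signal splits into the mismatch of the kernels and the noise. -/
theorem circConv_add_sub_maskedConv_smul {h : EuclideanSpace ℂ (Fin n)} (hh : h ≠ 0)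
    (h₀ d x z : EuclideanSpace ℂ (Fin n)) (c : ℂ) :
    circConv h (hadamard d x) + z - maskedConv h₀ d ((c * (‖h‖ : ℂ)) • x) =
      z - (‖h‖ : ℂ) • maskedConv (c • h₀ - (‖h‖⁻¹ : ℂ) • h) d x := by
  have hn : (‖h‖ : ℂ) ≠ 0 := by exact_mod_cast (norm_ne_zero_iff.2 hh)
  ext i
  simp only [maskedConv_apply, PiLp.sub_apply, PiLp.add_apply, PiLp.smul_apply, circConv_apply,
    hadamard, smul_eq_mul, Finset.mul_sum]
  rw [add_comm, add_sub_assoc, ← Finset.sum_sub_distrib, sub_eq_add_neg (z.ofLp i),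
    ← Finset.sum_neg_distrib]
  congr 1
  refine Finset.sum_congr rfl fun j _ => ?_
  field_simp
  ring

theorem sum_compl_norm_smul_eq {x xk : EuclideanSpace ℂ (Fin n)} {S : Finset (Fin n)}
    (hS : ∀ i, xk i = if i ∈ S then x i else 0) (c : ℂ) :
    ∑ i ∈ Sᶜ, ‖(c • x) i‖ = ‖c‖ * oneNorm (x - xk) := by
  rw [oneNorm, ← Finset.sum_add_sum_compl S, Finset.sum_eq_zero (s := S), zero_add, Finset.mul_sum]
  · refine Finset.sum_congr rfl fun i hi => ?_
    rw [PiLp.sub_apply, hS, if_neg (Finset.mem_compl.1 hi), sub_zero, PiLp.smul_apply, norm_smul]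
  · intro i hi
    rw [PiLp.sub_apply, hS, if_pos hi, sub_self, norm_zero]

theorem norm_sub_sq_le_two_mul {V : Type*} [SeminormedAddCommGroup V] (a b : V) :
    ‖a - b‖ ^ 2 ≤ 2 * ‖a‖ ^ 2 + 2 * ‖b‖ ^ 2 := by
  have h := norm_sub_le a b
  have h2 : ‖a - b‖ ^ 2 ≤ (‖a‖ + ‖b‖) ^ 2 := by gcongr
  nlinarith [sq_nonneg (‖a‖ - ‖b‖)]

theorem exp_neg_le_rpow {n : ℕ} (hn : 0 < n) {a t : ℝ} (ht : a * Real.log n ≤ t) :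
    Real.exp (-t) ≤ (n : ℝ) ^ (-a) := by
  rw [Real.rpow_def_of_pos (by exact_mod_cast hn)]
  exact Real.exp_le_exp.2 (by linarith)

end Recovery

theorem theorem4 :
    ∃ c C₁ C₂ : ℝ, 0 < c ∧ 0 < C₁ ∧ 0 < C₂ ∧
      ∀ (Ω Ω' : Type*) [MeasurableSpace Ω] [MeasurableSpace Ω']
        (P : Measure Ω) [IsProbabilityMeasure P] (Q : Measure Ω') [IsProbabilityMeasure Q]
        (n L K : ℕ) (g : Ω' → ℂ) (ν : ℝ) (d : Fin L → Ω → EuclideanSpace ℂ (Fin n))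
        (h x h₀ : EuclideanSpace ℂ (Fin n)) (Z : Ω → Fin L → EuclideanSpace ℂ (Fin n))
        (C ε θ₀ lam : ℝ),
        IsMaskVariable Q g ν →
        AreIndepCopies P d Q g →
        h ≠ 0 → ‖x‖ = 1 → IsSparse K x →
        0 < C → (∀ᵐ ω ∂P, frobNorm (Z ω) ≤ C * ‖x‖ * ‖h‖) →
        ‖h₀‖ = 1 →
        phaseDist h₀ ((‖h‖⁻¹ : ℂ) • h) < ε →
        phaseDist h₀ ((‖h‖⁻¹ : ℂ) • h) =
          ‖Complex.exp (Complex.I * θ₀) • h₀ - (‖h‖⁻¹ : ℂ) • h‖ →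
        2 * (2 * ε + C) * ‖h‖ * ‖x‖ ≤ lam →
        c * (coherence h₀ * ν ^ 2 * Real.log n) ≤ L →
        ∃ E : Set Ω, MeasurableSet E ∧ 1 - 2 / (n : ℝ) ≤ P.real E ∧ ∀ ω ∈ E,
          (∃ xs, IsLassoSolution h₀ (fun l => d l ω)
            (fun l => circConv h (hadamard (d l ω) x) + Z ω l) lam xs) ∧
          ∀ xs, IsLassoSolution h₀ (fun l => d l ω)
            (fun l => circConv h (hadamard (d l ω) x) + Z ω l) lam xs →
            ∀ k ∈ Finset.Icc 1 K, ∀ xk, IsBestSparseApprox k x xk →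
              ‖xs - (Complex.exp (Complex.I * θ₀) * (‖h‖ : ℂ)) • x‖ ≤
                C₁ * Real.sqrt k * lam + C₂ * (‖h‖ * oneNorm (x - xk) / Real.sqrt k) := by
  refine ⟨24, 50, 1, by norm_num, by norm_num, by norm_num, ?_⟩
  intro Ω Ω' _ _ P _ Q _ n L K g ν d h x h₀ Z C ε θ₀ lam hg hd hh hx _ hC hZ hh₀ hε hθ hlam hL
  rcases Nat.lt_or_ge 2 n with hn | hn
  swap
  · -- for `n ≤ 2` the claimed probability is not positive, except that `n = 0` is impossible
    refine ⟨∅, MeasurableSet.empty, ?_, by simp⟩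
    have hn0 : n ≠ 0 := by
      rintro rfl
      simp [EuclideanSpace.norm_eq] at hx
    have hn1 : (0 : ℝ) < n := by exact_mod_cast Nat.pos_of_ne_zero hn0
    have hn2 : (n : ℝ) ≤ 2 := by exact_mod_cast hn
    have : 1 ≤ 2 / (n : ℝ) := by rwa [one_le_div hn1]
    simpa using this
  have hn0 : (0 : ℝ) < n := by exact_mod_cast (by omega : 0 < n)
  have hlog : 0 < Real.log n := Real.log_pos (by exact_mod_cast (by omega : 1 < n))
  have hν1 := hg.one_le
  have hν0 : 0 < ν := by linarith
  have hh₀0 : h₀ ≠ 0 := by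
    rintro rfl
    simp at hh₀
  have hμ1 := one_le_coherence hh₀0
  have hμ : coherence h₀ = supNorm (dft h₀) ^ 2 := by rw [coherence, hh₀]; norm_num
  set e := Complex.exp (Complex.I * θ₀) • h₀ - (‖h‖⁻¹ : ℂ) • h with he
  have heε : ‖e‖ < ε := hθ ▸ hε
  have hε0 : 0 < ε := (norm_nonneg e).trans_lt heε
  have hhn : 0 < ‖h‖ := norm_pos_iff.2 hh
  rw [hx, mul_one] at hlam
  simp only [hx, mul_one] at hZ
  have hlam0 : 0 < lam := lt_of_lt_of_le (by positivity) hlam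
  set R := coherence h₀ * ν ^ 2 with hR
  have hνsq : 1 ≤ ν ^ 2 := one_le_pow₀ hν1
  have hνR : ν ^ 2 ≤ R := le_mul_of_one_le_left (by positivity) hμ1
  have hR1 : 1 ≤ R := hνsq.trans hνR
  have hL0 : 0 < L := by
    have : (0 : ℝ) < L := lt_of_lt_of_le (by positivity) hL
    exact_mod_cast this
  have hL1 : (1 : ℝ) ≤ L := by exact_mod_cast hL0
  obtain ⟨d', hd'm, hd'i, hd'ν, hd'0, hd'1, hd'd⟩ := exists_bounded_measurable_masks hg hd
  -- the bad events: `A` is not bounded below, the kernel mismatch is amplified, the almost sure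
  -- assumptions fail
  set B₁ : Set Ω := {ω | ∃ w, ∑ l, ‖maskedConv h₀ (WithLp.toLp 2 fun j => d' (l, j) ω) w‖ ^ 2 <
      L / 6 * ‖w‖ ^ 2} with hB₁
  set m : Fin n → EuclideanSpace ℂ (Fin n) := fun j => WithLp.toLp 2 fun i => e (i - j) * x j
  set B₂ : Set Ω := {ω | 10 * ε ^ 2 * L ≤ ∑ l, ‖∑ j, d' (l, j) ω • m j‖ ^ 2} with hB₂
  set N : Set Ω := {ω | ¬ (frobNorm (Z ω) ≤ C * ‖h‖ ∧
    ∀ p : Fin L × Fin n, d' p ω = d p.1 ω p.2)} with hN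
  have hPN : P.real N = 0 := by
    have : P N = 0 := ae_iff.1 (hZ.and hd'd)
    simp [Measure.real, this]
  have hP₁ : P.real B₁ ≤ 1 / n := by
    refine (measure_exists_sum_norm_maskedConv_lt_le hd'm hd'i hd'ν hν0.le hd'0 hd'1 hh₀ hR1
      (by rw [hR, hμ])).trans ?_
    have h1 : 2 * Real.log n ≤ L / (12 * R) := by
      rw [le_div_iff₀ (by positivity)]
      linarith
    refine (mul_le_mul_of_nonneg_left (exp_neg_le_rpow (by omega) h1) hn0.le).trans_eq ?_
    rw [Real.rpow_neg hn0.le, Real.rpow_two]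
    field_simp
  have hP₂ : P.real B₂ ≤ 1 / n := by
    refine (measure_sum_norm_sq_ge_le hd'm hd'i hd'ν hν0 hd'0 (fun p => (hd'1 p).le) m hε0
      ?_).trans ?_
    · rw [sum_norm_sq_column, hx, one_pow, mul_one]
      gcongr
    have h1 : 1 * Real.log n ≤ L / (8 * ν ^ 2) := by
      rw [le_div_iff₀ (by positivity)]
      have := mul_le_mul_of_nonneg_right hνR hlog.le
      have h2 : 0 < R * Real.log n := by positivity
      linarith
    refine (exp_neg_le_rpow (by omega) h1).trans_eq ?_
    rw [Real.rpow_neg_one, one_div]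
  have hbad : P.real (B₁ ∪ B₂ ∪ N) ≤ 2 / n := by
    have h1 := measureReal_union_le (μ := P) (B₁ ∪ B₂) N
    have h2 := measureReal_union_le (μ := P) B₁ B₂
    have h3 : (2 : ℝ) / n = 1 / n + 1 / n := by ring
    linarith
  -- `B₁ ∪ B₂ ∪ N` need not be measurable, as nothing is assumed about `Z`
  refine ⟨(toMeasurable P (B₁ ∪ B₂ ∪ N))ᶜ, (measurableSet_toMeasurable _ _).compl, ?_, ?_⟩
  · rw [probReal_compl_eq_one_sub (measurableSet_toMeasurable _ _)]
    have : P.real (toMeasurable P (B₁ ∪ B₂ ∪ N)) = P.real (B₁ ∪ B₂ ∪ N) := by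
      rw [Measure.real, measure_toMeasurable, Measure.real]
    linarith
  intro ω hω
  have hω' : ω ∉ B₁ ∪ B₂ ∪ N := fun hc => hω (subset_toMeasurable _ _ hc)
  simp only [Set.mem_union, not_or] at hω'
  obtain ⟨⟨hω₁, hω₂⟩, hωN⟩ := hω'
  simp only [hB₁, hB₂, hN, Set.mem_ofPred_eq, not_exists, not_lt, not_le, not_not] at hω₁ hω₂ hωN
  obtain ⟨hZω, hdω⟩ := hωN
  have hdl : ∀ l, (WithLp.toLp 2 fun j => d' (l, j) ω) = d l ω := by
    intro l
    ext j
    exact hdω (l, j)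
  simp only [hdl] at hω₁
  refine ⟨exists_isLassoSolution h₀ _ _ hlam0, fun xs hxs k hk xk hxk => ?_⟩
  obtain ⟨S, hScard, -, hS⟩ := hxk
  have hc : ‖Complex.exp (Complex.I * θ₀) * (‖h‖ : ℂ)‖ = ‖h‖ := by
    rw [norm_mul, mul_comm Complex.I, Complex.norm_exp_ofReal_mul_I, one_mul, Complex.norm_real,
      norm_norm]
  have hnoise : ∑ l, ‖circConv h (hadamard (d l ω) x) + Z ω l - maskedConv h₀ (d l ω)
      ((Complex.exp (Complex.I * θ₀) * (‖h‖ : ℂ)) • x)‖ ^ 2 ≤ 2 * L * lam ^ 2 := by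
    have h1 : ∀ l, ‖circConv h (hadamard (d l ω) x) + Z ω l - maskedConv h₀ (d l ω)
        ((Complex.exp (Complex.I * θ₀) * (‖h‖ : ℂ)) • x)‖ ^ 2 ≤
        2 * ‖Z ω l‖ ^ 2 + 2 * ‖h‖ ^ 2 * ‖∑ j, d' (l, j) ω • m j‖ ^ 2 := by
      intro l
      rw [circConv_add_sub_maskedConv_smul hh]
      refine (norm_sub_sq_le_two_mul _ _).trans_eq ?_
      rw [norm_smul, Complex.norm_real, norm_norm, mul_pow, maskedConv_eq_sum]
      simp only [← hdl]
      ring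
    have h2 := Finset.sum_le_sum fun l (_ : l ∈ Finset.univ) => h1 l
    rw [Finset.sum_add_distrib, ← Finset.mul_sum, ← Finset.mul_sum] at h2
    have h3 : ∑ l, ‖Z ω l‖ ^ 2 ≤ (C * ‖h‖) ^ 2 := by
      have h4 := (Real.sqrt_le_iff.1 hZω).2
      simpa only [EuclideanSpace.norm_sq_eq] using h4
    have h5 : C * ‖h‖ ≤ lam / 2 := by nlinarith [mul_pos hε0 hhn]
    have h6 : ε * ‖h‖ ≤ lam / 4 := by nlinarith [mul_pos hC hhn]
    have h7 : (C * ‖h‖) ^ 2 ≤ (lam / 2) ^ 2 := by gcongr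
    have h8 : (ε * ‖h‖) ^ 2 ≤ (lam / 4) ^ 2 := by gcongr
    have h9 : 2 * ‖h‖ ^ 2 * ∑ l, ‖∑ j, d' (l, j) ω • m j‖ ^ 2 ≤
        2 * ‖h‖ ^ 2 * (10 * ε ^ 2 * L) := by gcongr
    have h10 : 2 * ‖h‖ ^ 2 * (10 * ε ^ 2 * L) ≤ 20 * (lam / 4) ^ 2 * L := by
      calc _ = 20 * (ε * ‖h‖) ^ 2 * L := by ring
        _ ≤ _ := by gcongr
    have h11 : lam ^ 2 ≤ L * lam ^ 2 := le_mul_of_one_le_left (sq_nonneg lam) hL1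
    linarith [sq_nonneg lam]
  have hkc : S.card ≤ k := hScard.trans_le (min_le_left _ _)
  have hfinal := norm_lassoSolution_sub_le hL0 hlam0 hxs hω₁ hnoise (Finset.mem_Icc.1 hk).1 hkc
  rw [sum_compl_norm_smul_eq hS, hc] at hfinal
  rw [one_mul]
  exact hfinal
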